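/- Let $\mathscr{X}$ be a special Kähler manifold of complex dimension $r$: a complex manifold covered by holomorphic charts $a=(a^1,\dots,a^r)$ (special coordinates), each with a holomorphic prepotential $\mathcal F(a)$ such that $\mathrm{Im}\,\tau_{ij}$ is positive definite, where $\tau_{ij}=\partial^2\mathcal F/\partial a^i\partial a^j$; the vectors $(a^i,\partial\mathcal F/\partial a^i)$ of any two of them are related, locally on the overlaps, by a transformation in $Sp(2r,\mathbb R)$ followed by a constant complex translation; and $\mathscr X$ carries the Kähler metric $G$ that reads $ds^2=\mathrm{Im}(\tau_{ij})\,da^i\,d\bar a^{\bar j}$ in each of them. Let $\tau\colon\mathscr X\to\mathscr H$ be a period map, i.e. a map to Siegel's upper half-space (symmetric complex $r\times r$ matrices with positive-definite imaginary part) which near every point is given by $\tau_{ij}=\partial^2\mathcal F/\partial a^i\partial a^j$ in some special coordinates. Let $\boldsymbol\tau\in\mathscr H$ be such that the fiber $\mathscr X_{\boldsymbol\tau}=\tau^{-1}(\boldsymbol\tau)$ is an embedded complex submanifold of $\mathscr X$, of pure dimension, with inclusion $i_{\boldsymbol\tau}\colon\mathscr X_{\boldsymbol\tau}\hookrightarrow\mathscr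 X$. **(1)** The Chern connection $\nabla^{\mathscr X}$ of $(T\mathscr X,G)$ is the Levi-Civita connection of $G$, and the restriction $i_{\boldsymbol\tau}^*T\mathscr X\to\mathscr X_{\boldsymbol\tau}$ of the holomorphic tangent bundle is flat for the restricted connection $i_{\boldsymbol\tau}^*\nabla^{\mathscr X}$. **(2)** Equip $\mathscr X_{\boldsymbol\tau}$ with the metric induced by $G$; it is Kähler (its Chern connection is its Levi-Civita connection). **(2a)** The Riemann tensor of $\mathscr X_{\boldsymbol\tau}$ is Nakano non-positive, i.e. $R_{i\bar jk\bar l}\,u^{ik}\,\bar u^{\bar j\bar l}\le 0$ for all tensors $u^{ik}$ (with the sign convention $R_{i\bar jk\bar l}=-\partial_i\partial_{\bar j}G_{k\bar l}+G^{\bar n m}\partial_iG_{k\bar n}\partial_{\bar j}G_{m\bar l}$ for a Kähler metric $G$); its Ricci form and its holomorphic bisectional curvatures are also non-positive. **(2b)** The induced metric on $\mathscr X_{\boldsymbol\tau}$ is flat if and only if $\mathscr X_{\boldsymbol\tau}$ is totally geodesic in $\mathscr X$ (its second fundamental form vanishes). In that case $\mathscr X_{\boldsymbol\tau}$ is a holomorphic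 flat, i.e. a complex submanifold which is totally geodesic and whose induced metric is flat. -/

import Mathlib

open scoped Manifold ContDiff Topology Matrix ComplexOrder ComplexConjugate

namespace SpecialGeometry

noncomputable section

/-! ### Local objects on open subsets of `ℂⁿ` -/

/-- The model space `ℂⁿ`. -/
abbrev Cn (n : ℕ) : Type := EuclideanSpace ℂ (Fin n)

/-- The `i`-th coordinate vector of `ℂⁿ`. -/
def basisVec {n : ℕ} (i : Fin n) : Cn n := EuclideanSpace.single i (1 : ℂ)

/-- Action of a square matrix on a vector of `ℂⁿ`. -/
def act {n : ℕ} (A : Matrix (Fin n) (Fin n) ℂ) (v : Cn n) : Cn n :=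
  WithLp.toLp 2 (A *ᵥ v.ofLp)

/-- The `(1,0)`-part of the differential, `∂f(v) = (df(v) - i df(iv)) / 2`. -/
def del {n : ℕ} (f : Cn n → ℂ) (z v : Cn n) : ℂ :=
  (fderiv ℝ f z v - Complex.I * fderiv ℝ f z (Complex.I • v)) / 2

/-- Connection matrices of one-forms on (an open subset of) `ℂⁿ`, acting on sections of a trivial
bundle of rank `m`: `∇_u s = D_u s + A_z(u) s`. Tangent vectors `u` are real tangent vectors,
i.e. elements of `ℂⁿ` regarded as a real vector space. -/
abbrev ConnForm (n m : ℕ) : Type := Cn n → Cn n → Matrix (Fin m) (Fin m) ℂ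

/-- The curvature `dA + A ∧ A` of a connection form, on real tangent vectors `u`, `v`. -/
def ConnForm.curvature {n m : ℕ} (A : ConnForm n m) (z u v : Cn n) :
    Matrix (Fin m) (Fin m) ℂ :=
  (Matrix.of fun i j =>
      fderiv ℝ (fun z' => A z' v i j) z u - fderiv ℝ (fun z' => A z' u i j) z v)
    + (A z u * A z v - A z v * A z u)

/-- The curvature evaluated on the pair `(u', v̄')`, where `u' = (u - i·Ju)/2` is the
`(1,0)`-part of `u` and `v̄' = (v + i·Jv)/2` the `(0,1)`-part of `v`
(the curvature two-form is extended complex-bilinearly, `J` is the complex structure). -/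
def ConnForm.curvatureMixed {n m : ℕ} (A : ConnForm n m) (z u v : Cn n) :
    Matrix (Fin m) (Fin m) ℂ :=
  (1 / 4 : ℂ) • (A.curvature z u v + Complex.I • A.curvature z u (Complex.I • v)
    - Complex.I • A.curvature z (Complex.I • u) v
    + A.curvature z (Complex.I • u) (Complex.I • v))

/-- Pull-back of a connection form under a holomorphic map `f` between open subsets of
`ℂᵏ` and `ℂⁿ`: `(f^*A)_w(u) = A_{f(w)}(df_w(u))`. -/
def ConnForm.pullback {k n m : ℕ} (A : ConnForm n m) (f : Cn k → Cn n) : ConnForm k m :=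
  fun w u => A (f w) (fderiv ℂ f w u)

/-- The Chern connection form `H⁻¹ ∂H` of a Hermitian metric on a holomorphic bundle, written in a
holomorphic frame `e_k`, where `H l k = h(e_k, e_l)` (`h` is antilinear in its second argument). -/
def chernForm {n m : ℕ} (H : Cn n → Matrix (Fin m) (Fin m) ℂ) : ConnForm n m :=
  fun z u => (H z)⁻¹ * Matrix.of fun i j => del (fun z' => H z' i j) z u

/-! ### Hermitian metrics on complex manifolds -/

section Manifold

variable {n : ℕ} {X : Type*} [TopologicalSpace X] [ChartedSpace (Cn n) X]

variable (n X) in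
/-- A pairing on each holomorphic tangent space of the complex manifold `X`. -/
abbrev TangentPairing : Type _ :=
  ∀ x : X, TangentSpace 𝓘(ℂ, Cn n) x → TangentSpace 𝓘(ℂ, Cn n) x → ℂ

variable (n X) in
/-- The holomorphic charts of the complex manifold `X`. -/
abbrev holCharts : Set (OpenPartialHomeomorph X (Cn n)) :=
  IsManifold.maximalAtlas 𝓘(ℂ, Cn n) ω X

/-- The coordinate vector field `∂/∂zᵏ` of a chart `e` at the point with coordinates `z`. -/
def coordField (e : OpenPartialHomeomorph X (Cn n)) (z : Cn n) (k : Fin n) :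
    TangentSpace 𝓘(ℂ, Cn n) (e.symm z) :=
  mfderiv 𝓘(ℂ, Cn n) 𝓘(ℂ, Cn n) e.symm z (basisVec k)

/-- The matrix of `g` in the chart `e`: its entry `(l, k)` is `g(∂_k, ∂_l)`. -/
def metricMatrix (g : TangentPairing n X) (e : OpenPartialHomeomorph X (Cn n)) (z : Cn n) :
    Matrix (Fin n) (Fin n) ℂ :=
  Matrix.of fun l k => g (e.symm z) (coordField e z k) (coordField e z l)

/-- The Chern connection of the holomorphic tangent bundle of `(X, g)` in the chart `e`. -/
def chernConn (g : TangentPairing n X) (e : OpenPartialHomeomorph X (Cn n)) : ConnForm n n :=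
  chernForm (metricMatrix g e)

/-- The Chern connection of `g` is the Levi-Civita connection: in all holomorphic charts it is
torsion-free and preserves `g`. -/
def ChernIsLeviCivita (g : TangentPairing n X) : Prop :=
  ∀ e ∈ holCharts n X, ∀ z ∈ e.target, ∀ u v : Cn n,
    act (chernConn g e z u) v = act (chernConn g e z v) u ∧
    ∀ i j : Fin n, fderiv ℝ (fun z' => metricMatrix g e z' i j) z u =
      (metricMatrix g e z * chernConn g e z u
        + (chernConn g e z u)ᴴ * metricMatrix g e z) i j

/-- The Riemann tensor `R_{i j̄ k l̄} = g(R(∂_i, ∂_j̄) ∂_k, ∂_l)` in the chart `e`. -/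
def riemann (g : TangentPairing n X) (e : OpenPartialHomeomorph X (Cn n)) (z : Cn n)
    (i j k l : Fin n) : ℂ :=
  (metricMatrix g e z * (chernConn g e).curvatureMixed z (basisVec i) (basisVec j)) l k

/-- The components `R_{i j̄}` of the Ricci form: the trace of the curvature endomorphism. -/
def ricci (g : TangentPairing n X) (e : OpenPartialHomeomorph X (Cn n)) (z : Cn n)
    (i j : Fin n) : ℂ :=
  ((chernConn g e).curvatureMixed z (basisVec i) (basisVec j)).trace

/-- Nakano non-positivity: `R_{i j̄ k l̄} u^{ik} ū^{jl} ≤ 0` for all tensors `u`.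
(The inequality between complex numbers says that the left side is real and `≤ 0`.) -/
def NakanoNonpos (g : TangentPairing n X) : Prop :=
  ∀ e ∈ holCharts n X, ∀ z ∈ e.target, ∀ u : Fin n → Fin n → ℂ,
    ∑ i, ∑ j, ∑ k, ∑ l, riemann g e z i j k l * u i k * conj (u j l) ≤ 0

/-- The Ricci form is non-positive: `R_{i j̄} uⁱ ūʲ ≤ 0` for all vectors `u`. -/
def RicciNonpos (g : TangentPairing n X) : Prop :=
  ∀ e ∈ holCharts n X, ∀ z ∈ e.target, ∀ u : Fin n → ℂ,
    ∑ i, ∑ j, ricci g e z i j * u i * conj (u j) ≤ 0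

/-- The holomorphic bisectional curvatures are non-positive:
`R_{i j̄ k l̄} uⁱ ūʲ vᵏ v̄ˡ ≤ 0` for all vectors `u`, `v`. -/
def BisectionalNonpos (g : TangentPairing n X) : Prop :=
  ∀ e ∈ holCharts n X, ∀ z ∈ e.target, ∀ u v : Fin n → ℂ,
    ∑ i, ∑ j, ∑ k, ∑ l, riemann g e z i j k l * u i * conj (u j) * v k * conj (v l) ≤ 0

/-- The metric is flat: the curvature of its Chern connection vanishes identically. -/
def IsFlat (g : TangentPairing n X) : Prop :=
  ∀ e ∈ holCharts n X, ∀ z ∈ e.target, ∀ u v : Cn n, (chernConn g e).curvature z u v = 0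

/-! ### Submanifolds -/

variable {s : ℕ} {S : Type*} [TopologicalSpace S] [ChartedSpace (Cn s) S]

/-- The metric induced on `S` by `g` through `ι : S → X`. -/
def inducedMetric (g : TangentPairing n X) (ι : S → X) : TangentPairing s S :=
  fun x u v => g (ι x) (mfderiv 𝓘(ℂ, Cn s) 𝓘(ℂ, Cn n) ι x u)
    (mfderiv 𝓘(ℂ, Cn s) 𝓘(ℂ, Cn n) ι x v)

/-- The expression of `ι : S → X` in a chart `d` of `S` and a chart `e` of `X`. -/
def inCharts (ι : S → X) (d : OpenPartialHomeomorph S (Cn s))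
    (e : OpenPartialHomeomorph X (Cn n)) : Cn s → Cn n :=
  fun w => e (ι (d.symm w))

/-- The restriction `ι^*∇` of the Chern connection `∇` of `(X, g)`, a connection on the bundle
`ι^*TX` over `S`, in a chart `d` of `S` and the frame of `ι^*TX` given by a chart `e` of `X`. -/
def restrictedConn (g : TangentPairing n X) (ι : S → X) (d : OpenPartialHomeomorph S (Cn s))
    (e : OpenPartialHomeomorph X (Cn n)) : ConnForm s n :=
  (chernConn g e).pullback (inCharts ι d e)

/-- The bundle `ι^*TX → S` is flat for the restricted connection `ι^*∇`. -/
def RestrictedTangentFlat (g : TangentPairing n X) (ι : S → X) : Prop :=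
  ∀ d ∈ holCharts s S, ∀ e ∈ holCharts n X, ∀ w ∈ d.target, ι (d.symm w) ∈ e.source →
    ∀ u v : Cn s, (restrictedConn g ι d e).curvature w u v = 0

/-- `S` is totally geodesic in `(X, g)`: its second fundamental form vanishes, i.e. the ambient
covariant derivative `(ι^*∇)_u (dι V)` is tangent to `S` for every coordinate vector field
`V ≡ v` and every tangent vector `u` of `S`. -/
def IsTotallyGeodesic (g : TangentPairing n X) (ι : S → X) : Prop :=
  ∀ d ∈ holCharts s S, ∀ e ∈ holCharts n X, ∀ w ∈ d.target, ι (d.symm w) ∈ e.source →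
    ∀ u v : Cn s, ∃ t : Cn s,
      fderiv ℝ (fun w' => fderiv ℂ (inCharts ι d e) w' v) w u
        + act (restrictedConn g ι d e w u) (fderiv ℂ (inCharts ι d e) w v)
      = fderiv ℂ (inCharts ι d e) w t

/-- `S` is a holomorphic flat of `(X, g)`: a complex submanifold that is totally geodesic and
whose induced metric is flat. -/
structure IsHolomorphicFlat (g : TangentPairing n X) (ι : S → X) : Prop where
  embedding : Manifold.IsSmoothEmbedding 𝓘(ℂ, Cn s) 𝓘(ℂ, Cn n) ω ι
  totallyGeodesic : IsTotallyGeodesic (s := s) g ι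
  flat : IsFlat (inducedMetric (s := s) g ι)

end Manifold

/-! ### Special Kähler manifolds and their period maps -/

/-- The gradient `∂F/∂aⁱ` of a holomorphic function. -/
def gradient {r : ℕ} (F : Cn r → ℂ) (a : Cn r) (i : Fin r) : ℂ :=
  fderiv ℂ F a (basisVec i)

/-- The matrix `∂²F/∂aⁱ∂aʲ` of a holomorphic function. -/
def hessian {r : ℕ} (F : Cn r → ℂ) (a : Cn r) : Matrix (Fin r) (Fin r) ℂ :=
  Matrix.of fun i j => fderiv ℂ (fun a' => gradient F a' i) a (basisVec j)

/-- Siegel's upper half-space: symmetric complex matrices with positive-definite imaginary part. -/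
def SiegelSpace (r : ℕ) : Type :=
  {M : Matrix (Fin r) (Fin r) ℂ // M.IsSymm ∧ (M.map Complex.im).PosDef}

/-- Special coordinates `a` on an open subset of the complex manifold `X`, together with a
holomorphic prepotential `F` whose Hessian has positive-definite imaginary part. -/
structure SpecialChart (r : ℕ) (X : Type*) [TopologicalSpace X] [ChartedSpace (Cn r) X] where
  /-- the special coordinates -/
  a : OpenPartialHomeomorph X (Cn r)
  a_mem : a ∈ holCharts r X
  /-- the prepotential -/
  F : Cn r → ℂ
  holomorphic : DifferentiableOn ℂ F a.target
  posDef : ∀ z ∈ a.target, ((hessian F z).map Complex.im).PosDef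

namespace SpecialChart

variable {r : ℕ} {X : Type*} [TopologicalSpace X] [ChartedSpace (Cn r) X]

/-- The matrix `τ_{ij} = ∂²F/∂aⁱ∂aʲ` as a function on `X`. -/
def periodMatrix (c : SpecialChart r X) (x : X) : Matrix (Fin r) (Fin r) ℂ :=
  hessian c.F (c.a x)

/-- The vector `(aⁱ, ∂F/∂aⁱ)` of all `2r` special periods. -/
def periods (c : SpecialChart r X) (x : X) : Fin r ⊕ Fin r → ℂ :=
  Sum.elim (c.a x).ofLp (gradient c.F (c.a x))

/-- Components `daⁱ(v)` of a tangent vector in special coordinates. -/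
def da (c : SpecialChart r X) (x : X) (v : TangentSpace 𝓘(ℂ, Cn r) x) : Cn r :=
  mfderiv 𝓘(ℂ, Cn r) 𝓘(ℂ, Cn r) c.a x v

end SpecialChart

/-- A special Kähler structure on a complex manifold `X` of dimension `r`: an atlas of special
coordinates, related by real symplectic transformations and complex translations of the periods
`(a, ∂F/∂a)`, and the Kähler metric given by `Im(τ_{ij}) daⁱ dāʲ` in all of them. -/
structure SpecialKahlerStructure (r : ℕ) (X : Type*) [TopologicalSpace X]
    [ChartedSpace (Cn r) X] where
  /-- the special Kähler metric -/
  metric : TangentPairing r X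
  /-- the special coordinate systems -/
  charts : Set (SpecialChart r X)
  cover : ∀ x : X, ∃ c ∈ charts, x ∈ c.a.source
  transition : ∀ c ∈ charts, ∀ c' ∈ charts, ∀ x ∈ c.a.source ∩ c'.a.source,
    ∃ M ∈ Matrix.symplecticGroup (Fin r) ℝ, ∃ b : Fin r ⊕ Fin r → ℂ,
      ∀ᶠ y in 𝓝 x, c'.periods y = M.map Complex.ofReal *ᵥ c.periods y + b
  metric_eq : ∀ c ∈ charts, ∀ x ∈ c.a.source, ∀ v w : TangentSpace 𝓘(ℂ, Cn r) x,
    metric x v w = ∑ i, ∑ j, ((c.periodMatrix x i j).im : ℂ) * c.da x v i * conj (c.da x w j)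

/-- `τ : X → ℋ` is a period map of a special Kähler structure, to Siegel's upper half-space:
near each point it is given by `∂²F/∂aⁱ∂aʲ` in some special coordinates. -/
def IsPeriodMap {r : ℕ} {X : Type*} [TopologicalSpace X] [ChartedSpace (Cn r) X]
    (K : SpecialKahlerStructure r X) (τ : X → SiegelSpace r) : Prop :=
  ∀ x : X, ∃ c ∈ K.charts, x ∈ c.a.source ∧ ∀ᶠ y in 𝓝 x, (τ y).1 = c.periodMatrix y

end

end SpecialGeometry

open SpecialGeometry

namespace SpecialGeometry

/-! ### Regularity of holomorphic functions of several variables -/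

section Holomorphic

variable {E : Type*} [NormedAddCommGroup E] [NormedSpace ℂ E]

/-! Near a point of the fiber, choose special coordinates whose Hessian computes the period map.
Along the fiber that Hessian is the constant `τ₀`, and two things follow.

First, in these coordinates the Chern form is `H⁻¹ ∂H` with `H = Im τ`. As `τ` is holomorphic,
`∂H(u) = dτ(u) / (2i)`, which vanishes for `u` tangent to the fiber. So the restricted connection is
zero in the frame `∂/∂aⁱ`, hence of the form `G⁻¹ dG` in any other holomorphic frame, and flat
(`IsFlatChartAt.restrictedConn_curvature`).

Second, the fiber is locally a complex submanifold of `ℂʳ` with the constant Hermitian form `Im τ₀`.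
Let `J` be the Jacobian of the inclusion, `h = Jᴴ H₀ J` the induced metric, `β_u = dJ(u)`, and `N`
the form `H₀` evaluated on normal components. The Gauss equation (`curvatureMixed_pullback_const`)
reads `R(u, v̄) = -h⁻¹ β_vᴴ N β_u` with `N` positive semidefinite. The Nakano form is therefore
minus the `N`-norm squared of `∑ β_i u_i`; the Ricci form is minus the trace of a product of two
positive semidefinite matrices; the bisectional curvatures are Nakano values at decomposable
tensors. Flatness forces `β_u v` to have `N`-norm zero, that is, to be tangent, which is the
vanishing of the second fundamental form; conversely `N β = 0` kills the curvature.

The Kähler property holds on every complex submanifold, since it only uses symmetry of the third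
derivatives of the prepotential and of the second derivatives of the inclusion. Those third
derivatives exist because complex differentiability on an open set implies smoothness
(`contDiffOn_of_differentiableOn`). -/

lemma hasDerivAt_comp_line {f : E → ℂ} {y w : E} {ζ : ℂ}
    (hf : DifferentiableAt ℂ f (y + ζ • w)) :
    HasDerivAt (fun ζ : ℂ => f (y + ζ • w)) (fderiv ℂ f (y + ζ • w) w) ζ := by
  have h : HasDerivAt (fun ζ : ℂ => y + ζ • w) w ζ := by
    simpa using ((hasDerivAt_id ζ).smul_const w).const_add y
  exact hf.hasFDerivAt.comp_hasDerivAt ζ h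

/-- Cauchy's estimate for the differential of a bounded holomorphic function. -/
lemma norm_fderiv_le_of_forall_mem_ball {f : E → ℂ} {z₀ y : E} {δ M : ℝ} (hδ : 0 < δ)
    (hf : ∀ z ∈ Metric.ball z₀ (4 * δ), DifferentiableAt ℂ f z)
    (hM : ∀ z ∈ Metric.ball z₀ (4 * δ), ‖f z‖ ≤ M) (hy : y ∈ Metric.ball z₀ (2 * δ)) :
    ‖fderiv ℂ f y‖ ≤ M / δ := by
  have hM0 : 0 ≤ M := (norm_nonneg _).trans (hM z₀ (Metric.mem_ball_self (by positivity)))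
  refine ContinuousLinearMap.opNorm_le_bound _ (by positivity) fun w => ?_
  rcases eq_or_ne w 0 with rfl | hw
  · simp
  have hw' : 0 < ‖w‖ := norm_pos_iff.2 hw
  -- The disc of radius `δ / ‖w‖` in the direction `w` moves `y` by at most `δ`, so it stays within
  -- `3δ` of `z₀`; the one-variable Cauchy estimate on it gives the bound.
  have hmem : ∀ ζ ∈ Metric.closedBall (0 : ℂ) (δ / ‖w‖),
      y + ζ • w ∈ Metric.ball z₀ (4 * δ) := by
    intro ζ hζ
    have h1 : ‖ζ‖ * ‖w‖ ≤ δ := by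
      rw [mem_closedBall_zero_iff, le_div_iff₀ hw'] at hζ
      exact hζ
    have h2 : ‖y - z₀‖ < 2 * δ := by simpa [dist_eq_norm] using hy
    rw [Metric.mem_ball, dist_eq_norm]
    calc ‖y + ζ • w - z₀‖ = ‖(y - z₀) + ζ • w‖ := by congr 1; abel
      _ ≤ ‖y - z₀‖ + ‖ζ‖ * ‖w‖ := (norm_add_le _ _).trans (by rw [norm_smul])
      _ < 4 * δ := by linarith
  have hd : ∀ ζ ∈ Metric.closedBall (0 : ℂ) (δ / ‖w‖),
      DifferentiableAt ℂ (fun ζ : ℂ => f (y + ζ • w)) ζ := fun ζ hζ =>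
    (hasDerivAt_comp_line (hf _ (hmem ζ hζ))).differentiableAt
  have hdc : DiffContOnCl ℂ (fun ζ : ℂ => f (y + ζ • w)) (Metric.ball 0 (δ / ‖w‖)) := by
    refine DifferentiableOn.diffContOnCl fun ζ hζ => ?_
    exact (hd ζ (Metric.closure_ball_subset_closedBall hζ)).differentiableWithinAt
  have key := Complex.norm_deriv_le_of_forall_mem_sphere_norm_le (C := M) (by positivity) hdc
    fun ζ hζ => hM _ (hmem ζ (Metric.sphere_subset_closedBall hζ))
  have h0 : DifferentiableAt ℂ f (y + (0 : ℂ) • w) :=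
    hf _ (hmem 0 (Metric.mem_closedBall_self (by positivity)))
  rw [(hasDerivAt_comp_line h0).deriv] at key
  simp only [zero_smul, add_zero] at key
  calc ‖fderiv ℂ f y w‖ ≤ M / (δ / ‖w‖) := key
    _ = M / δ * ‖w‖ := by field_simp

lemma add_smul_mem_ball {z₀ x v : E} {δ ρ : ℝ} (hρv : ρ * ‖v‖ ≤ δ)
    (hx : x ∈ Metric.ball z₀ δ) {ζ : ℂ} (hζ : ‖ζ‖ ≤ ρ) :
    x + ζ • v ∈ Metric.ball z₀ (2 * δ) := by
  have h2 : ‖x - z₀‖ < δ := by simpa [dist_eq_norm] using hx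
  have h3 : ‖ζ‖ * ‖v‖ ≤ ρ * ‖v‖ := by gcongr
  rw [Metric.mem_ball, dist_eq_norm]
  calc ‖x + ζ • v - z₀‖ = ‖(x - z₀) + ζ • v‖ := by congr 1; abel
    _ ≤ ‖x - z₀‖ + ‖ζ‖ * ‖v‖ := (norm_add_le _ _).trans (by rw [norm_smul])
    _ < 2 * δ := by linarith

/-- Cauchy's formula on the complex line through `z` in the direction `v` writes the directional
derivative as a circle integral of values of `f`, which can be differentiated under the integral
sign. The dominating bound is Cauchy's estimate, so continuity of `fderiv ℂ f` is not presupposed.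
-/
lemma differentiableAt_fderiv_apply [FiniteDimensional ℂ E] {f : E → ℂ} {U : Set E}
    (hU : IsOpen U) (hf : DifferentiableOn ℂ f U) {z₀ : E} (hz₀ : z₀ ∈ U) (v : E) :
    DifferentiableAt ℂ (fun z => fderiv ℂ f z v) z₀ := by
  have hcont : ContinuousAt f z₀ := (hf.differentiableAt (hU.mem_nhds hz₀)).continuousAt
  have hb : ∀ᶠ z in 𝓝 z₀, z ∈ U ∧ ‖f z‖ ≤ ‖f z₀‖ + 1 :=
    Filter.Eventually.and (hU.mem_nhds hz₀) (hcont.norm.eventually_le_const (by simp))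
  obtain ⟨ε, hε, hball⟩ := Metric.eventually_nhds_iff_ball.1 hb
  set δ := ε / 4 with hδdef
  have hδ : 0 < δ := by positivity
  have hεδ : ε = 4 * δ := by rw [hδdef]; ring
  rw [hεδ] at hball
  set M := ‖f z₀‖ + 1
  have hd : ∀ z ∈ Metric.ball z₀ (4 * δ), DifferentiableAt ℂ f z := fun z hz =>
    hf.differentiableAt (hU.mem_nhds (hball z hz).1)
  have hM : ∀ z ∈ Metric.ball z₀ (4 * δ), ‖f z‖ ≤ M := fun z hz => (hball z hz).2
  -- The `+ 1` keeps the radius finite and positive when `v = 0`.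
  set ρ := δ / (‖v‖ + 1) with hρdef
  have hρ : 0 < ρ := by positivity
  have hρv : ρ * ‖v‖ ≤ δ := by
    rw [hρdef, div_mul_eq_mul_div, div_le_iff₀ (by positivity)]
    nlinarith [norm_nonneg v]
  have hsub : Metric.ball z₀ (2 * δ) ⊆ Metric.ball z₀ (4 * δ) :=
    Metric.ball_subset_ball (by linarith)
  have hnorm : ∀ θ : ℝ, ‖circleMap 0 ρ θ‖ = ρ := fun θ => by
    simp [abs_of_pos hρ]
  have hne : ∀ θ : ℝ, circleMap 0 ρ θ ≠ 0 := fun θ => circleMap_ne_center hρ.ne'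
  set c : ℝ → ℂ := fun θ => deriv (circleMap 0 ρ) θ * (1 / circleMap 0 ρ θ ^ 2) with hc
  have hccont : Continuous c := by
    simp only [hc, deriv_circleMap]
    refine ((continuous_circleMap _ _).mul continuous_const).mul ?_
    exact continuous_const.div ((continuous_circleMap _ _).pow 2) fun θ => pow_ne_zero 2 (hne θ)
  have hcnorm : ∀ θ, ‖c θ‖ = 1 / ρ := fun θ => by
    simp only [hc, deriv_circleMap, norm_mul, norm_div, norm_pow, hnorm, Complex.norm_I, norm_one]
    field_simp
  have hcauchy : ∀ x ∈ Metric.ball z₀ δ, fderiv ℂ f x v =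
      (2 * Real.pi * Complex.I : ℂ)⁻¹ *
        ∫ θ in (0 : ℝ)..2 * Real.pi, c θ * f (x + circleMap 0 ρ θ • v) := by
    intro x hx
    have hdiff : DifferentiableOn ℂ (fun ζ : ℂ => f (x + ζ • v)) (Metric.closedBall 0 ρ) :=
      fun ζ hζ => (hasDerivAt_comp_line (hd _ (hsub (add_smul_mem_ball hρv hx
        (by simpa using hζ))))).differentiableAt.differentiableWithinAt
    have h0 : DifferentiableAt ℂ f (x + (0 : ℂ) • v) :=
      hd _ (hsub (add_smul_mem_ball hρv hx (by simpa using hρ.le)))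
    have h1 := (hasDerivAt_comp_line h0).deriv
    have h2 := hdiff.deriv_eq_smul_circleIntegral hρ
    rw [h1, circleIntegral] at h2
    simp only [zero_smul, add_zero, sub_zero, smul_eq_mul, ← mul_assoc] at h2
    rw [h2, inv_mul_cancel_left₀ Complex.two_pi_I_ne_zero]
  have hcircle : ∀ x : E, Continuous fun θ : ℝ => x + circleMap 0 ρ θ • v := fun x =>
    continuous_const.add ((continuous_circleMap _ _).smul continuous_const)
  have hFcont : ∀ x ∈ Metric.ball z₀ δ,
      Continuous fun θ : ℝ => c θ * f (x + circleMap 0 ρ θ • v) := by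
    intro x hx
    refine hccont.mul (continuous_iff_continuousAt.2 fun θ => ?_)
    exact ContinuousAt.comp (f := fun θ : ℝ => x + circleMap 0 ρ θ • v)
      (hd _ (hsub (add_smul_mem_ball hρv hx (hnorm θ).le))).continuousAt (hcircle x).continuousAt
  have hint : DifferentiableAt ℂ
      (fun x => ∫ θ in (0 : ℝ)..2 * Real.pi, c θ * f (x + circleMap 0 ρ θ • v)) z₀ := by
    have hs : Metric.ball z₀ δ ∈ 𝓝 z₀ := Metric.ball_mem_nhds _ hδ
    have : ProperSpace E := FiniteDimensional.proper ℂ E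
    borelize E
    refine (intervalIntegral.hasFDerivAt_integral_of_dominated_of_fderiv_le (𝕜 := ℂ)
      (F' := fun x θ => c θ • fderiv ℂ f (x + circleMap 0 ρ θ • v))
      (bound := fun _ => 1 / ρ * (M / δ)) hs ?_ ?_ ?_ ?_ ?_ ?_).differentiableAt
    · filter_upwards [hs] with x hx
      exact (hFcont x hx).aestronglyMeasurable
    · exact (hFcont z₀ (Metric.mem_ball_self hδ)).intervalIntegrable _ _
    · refine hccont.aestronglyMeasurable.smul ?_
      -- A Fréchet derivative is measurable even where its continuity is not yet known.
      exact ((measurable_fderiv ℂ f).comp (hcircle z₀).measurable).aestronglyMeasurable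
    · refine Filter.Eventually.of_forall fun θ _ x hx => ?_
      rw [norm_smul, hcnorm]
      gcongr
      exact norm_fderiv_le_of_forall_mem_ball hδ hd hM (add_smul_mem_ball hρv hx (hnorm θ).le)
    · exact intervalIntegrable_const
    · refine Filter.Eventually.of_forall fun θ _ x hx => ?_
      have h := (hd _ (hsub (add_smul_mem_ball hρv hx (hnorm θ).le))).hasFDerivAt
      simpa using (h.comp x ((hasFDerivAt_id x).add_const (circleMap 0 ρ θ • v))).const_mul (c θ)
  refine (hint.const_mul (2 * Real.pi * Complex.I : ℂ)⁻¹).congr_of_eventuallyEq ?_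
  filter_upwards [Metric.ball_mem_nhds z₀ hδ] with x hx using hcauchy x hx

/-- A holomorphic function on an open subset of a finite-dimensional complex vector space is
infinitely often complex differentiable. -/
theorem contDiffOn_of_differentiableOn [FiniteDimensional ℂ E] {U : Set E} (hU : IsOpen U)
    (n : ℕ) {f : E → ℂ} (hf : DifferentiableOn ℂ f U) : ContDiffOn ℂ n f U := by
  induction n generalizing f with
  | zero => rw [Nat.cast_zero]; exact contDiffOn_zero.2 hf.continuousOn
  | succ n ih =>
    rw [Nat.cast_succ, contDiffOn_succ_iff_fderiv_of_isOpen hU]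
    refine ⟨hf, by simp, contDiffOn_clm_apply.2 fun v => ih fun z hz => ?_⟩
    exact (differentiableAt_fderiv_apply hU hf hz v).differentiableWithinAt

end Holomorphic

/-! ### Calculus of matrix-valued functions -/

section MatrixCalculus

variable {k m n p : ℕ}

/-- Entrywise real differentiability of a matrix-valued function. -/
def MatDiffAt (M : Cn k → Matrix (Fin m) (Fin n) ℂ) (z : Cn k) : Prop :=
  ∀ i j, DifferentiableAt ℝ (fun z' => M z' i j) z

/-- Entrywise complex differentiability of a matrix-valued function. -/
def MatHolAt (M : Cn k → Matrix (Fin m) (Fin n) ℂ) (z : Cn k) : Prop :=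
  ∀ i j, DifferentiableAt ℂ (fun z' => M z' i j) z

/-- The entrywise real directional derivative of a matrix-valued function. -/
noncomputable def matDeriv (M : Cn k → Matrix (Fin m) (Fin n) ℂ) (z u : Cn k) :
    Matrix (Fin m) (Fin n) ℂ :=
  Matrix.of fun i j => fderiv ℝ (fun z' => M z' i j) z u

/-- The entrywise `(1,0)`-part of the differential of a matrix-valued function. -/
noncomputable def matDel (M : Cn k → Matrix (Fin m) (Fin n) ℂ) (z u : Cn k) :
    Matrix (Fin m) (Fin n) ℂ :=
  Matrix.of fun i j => del (fun z' => M z' i j) z u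

lemma chernForm_eq (H : Cn k → Matrix (Fin m) (Fin m) ℂ) (z u : Cn k) :
    chernForm H z u = (H z)⁻¹ * matDel H z u := rfl

lemma matDel_eq (M : Cn k → Matrix (Fin m) (Fin n) ℂ) (z u : Cn k) :
    matDel M z u = (1 / 2 : ℂ) • (matDeriv M z u - Complex.I • matDeriv M z (Complex.I • u)) := by
  ext i j
  simp [matDel, matDeriv, del]
  ring

lemma curvature_eq (A : ConnForm k m) (z u v : Cn k) :
    A.curvature z u v = matDeriv (fun z' => A z' v) z u - matDeriv (fun z' => A z' u) z v
      + (A z u * A z v - A z v * A z u) := rfl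

section Congr

variable {M N : Cn k → Matrix (Fin m) (Fin n) ℂ} {z : Cn k}

lemma eventuallyEq_entry (h : M =ᶠ[𝓝 z] N) (i : Fin m) (j : Fin n) :
    (fun z' => M z' i j) =ᶠ[𝓝 z] fun z' => N z' i j := by
  filter_upwards [h] with z' hz' using by rw [hz']

lemma matDeriv_congr (h : M =ᶠ[𝓝 z] N) (u : Cn k) : matDeriv M z u = matDeriv N z u := by
  ext i j
  simp only [matDeriv, Matrix.of_apply, (eventuallyEq_entry h i j).fderiv_eq]

lemma matDel_congr (h : M =ᶠ[𝓝 z] N) (u : Cn k) : matDel M z u = matDel N z u := by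
  rw [matDel_eq, matDel_eq, matDeriv_congr h, matDeriv_congr h]

lemma chernForm_congr {H H' : Cn k → Matrix (Fin m) (Fin m) ℂ} (h : H =ᶠ[𝓝 z] H') (u : Cn k) :
    chernForm H z u = chernForm H' z u := by
  rw [chernForm_eq, chernForm_eq, matDel_congr h, h.eq_of_nhds]

lemma curvature_congr {A A' : ConnForm k m} (h : ∀ᶠ z' in 𝓝 z, ∀ u, A z' u = A' z' u)
    (u v : Cn k) : A.curvature z u v = A'.curvature z u v := by
  have h' : ∀ u, (fun z' => A z' u) =ᶠ[𝓝 z] fun z' => A' z' u := fun u => by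
    filter_upwards [h] with z' hz' using hz' u
  rw [curvature_eq, curvature_eq, matDeriv_congr (h' u), matDeriv_congr (h' v),
    (h' u).eq_of_nhds, (h' v).eq_of_nhds]

end Congr

lemma MatHolAt.matDiffAt {M : Cn k → Matrix (Fin m) (Fin n) ℂ} {z : Cn k} (h : MatHolAt M z) :
    MatDiffAt M z := fun i j => (h i j).restrictScalars ℝ

lemma matDiffAt_const (C : Matrix (Fin m) (Fin n) ℂ) (z : Cn k) :
    MatDiffAt (fun _ => C) z := fun _ _ => differentiableAt_const _

@[simp] lemma matDeriv_const (C : Matrix (Fin m) (Fin n) ℂ) (z u : Cn k) :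
    matDeriv (fun _ => C) z u = 0 := by
  ext i j
  simp [matDeriv]

lemma MatDiffAt.mul {M : Cn k → Matrix (Fin m) (Fin n) ℂ} {N : Cn k → Matrix (Fin n) (Fin p) ℂ}
    {z : Cn k} (hM : MatDiffAt M z) (hN : MatDiffAt N z) :
    MatDiffAt (fun z' => M z' * N z') z := fun i j => by
  simp only [Matrix.mul_apply]
  exact DifferentiableAt.fun_sum fun l _ => (hM i l).mul (hN l j)

lemma matDeriv_mul {M : Cn k → Matrix (Fin m) (Fin n) ℂ} {N : Cn k → Matrix (Fin n) (Fin p) ℂ}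
    {z : Cn k} (hM : MatDiffAt M z) (hN : MatDiffAt N z) (u : Cn k) :
    matDeriv (fun z' => M z' * N z') z u = matDeriv M z u * N z + M z * matDeriv N z u := by
  ext i j
  simp only [matDeriv, Matrix.mul_apply, Matrix.of_apply, Matrix.add_apply]
  rw [fderiv_fun_sum fun l _ => (hM i l).fun_mul (hN l j), ← Finset.sum_add_distrib]
  simp only [sum_apply]
  refine Finset.sum_congr rfl fun l _ => ?_
  rw [fderiv_fun_mul (hM i l) (hN l j)]
  simp [mul_comm, add_comm]

lemma matDel_mul {M : Cn k → Matrix (Fin m) (Fin n) ℂ} {N : Cn k → Matrix (Fin n) (Fin p) ℂ}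
    {z : Cn k} (hM : MatDiffAt M z) (hN : MatDiffAt N z) (u : Cn k) :
    matDel (fun z' => M z' * N z') z u = matDel M z u * N z + M z * matDel N z u := by
  simp only [matDel_eq, matDeriv_mul hM hN, Matrix.smul_mul, Matrix.mul_smul, Matrix.sub_mul,
    Matrix.mul_sub, smul_add]
  module

lemma MatDiffAt.conjTranspose {M : Cn k → Matrix (Fin m) (Fin n) ℂ} {z : Cn k}
    (hM : MatDiffAt M z) : MatDiffAt (fun z' => (M z')ᴴ) z := fun i j => by
  simp only [Matrix.conjTranspose_apply]
  exact (hM j i).star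

lemma matDeriv_conjTranspose {M : Cn k → Matrix (Fin m) (Fin n) ℂ} {z : Cn k}
    (u : Cn k) :
    matDeriv (fun z' => (M z')ᴴ) z u = (matDeriv M z u)ᴴ := by
  ext i j
  simp only [matDeriv, Matrix.conjTranspose_apply, Matrix.of_apply]
  rw [fderiv_star]
  simp

lemma MatHolAt.matDeriv_smul {M : Cn k → Matrix (Fin m) (Fin n) ℂ} {z : Cn k}
    (hM : MatHolAt M z) (c : ℂ) (u : Cn k) : matDeriv M z (c • u) = c • matDeriv M z u := by
  ext i j
  simp only [matDeriv, Matrix.of_apply, Matrix.smul_apply, (hM i j).fderiv_restrictScalars ℝ]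
  simp

lemma MatHolAt.matDel_eq_matDeriv {M : Cn k → Matrix (Fin m) (Fin n) ℂ} {z : Cn k}
    (hM : MatHolAt M z) (u : Cn k) : matDel M z u = matDeriv M z u := by
  rw [matDel_eq, hM.matDeriv_smul, smul_smul, Complex.I_mul_I]
  module

lemma MatHolAt.matDel_conjTranspose {M : Cn k → Matrix (Fin m) (Fin n) ℂ} {z : Cn k}
    (hM : MatHolAt M z) (u : Cn k) : matDel (fun z' => (M z')ᴴ) z u = 0 := by
  rw [matDel_eq, matDeriv_conjTranspose, matDeriv_conjTranspose, hM.matDeriv_smul,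
    Matrix.conjTranspose_smul, smul_smul]
  simp

lemma matDeriv_comp {M : Cn n → Matrix (Fin m) (Fin p) ℂ} {f : Cn k → Cn n} {w : Cn k}
    (hM : MatDiffAt M (f w)) (hf : DifferentiableAt ℂ f w) (u : Cn k) :
    matDeriv (fun w' => M (f w')) w u = matDeriv M (f w) (fderiv ℂ f w u) := by
  ext i j
  simp only [matDeriv, Matrix.of_apply]
  have h := (hM i j).hasFDerivAt.comp w (hf.hasFDerivAt.restrictScalars ℝ)
  rw [show (fun w' => M (f w') i j) = (fun z' => M z' i j) ∘ f from rfl, h.fderiv]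
  rfl

lemma MatDiffAt.comp {M : Cn n → Matrix (Fin m) (Fin p) ℂ} {f : Cn k → Cn n} {w : Cn k}
    (hM : MatDiffAt M (f w)) (hf : DifferentiableAt ℂ f w) :
    MatDiffAt (fun w' => M (f w')) w := fun i j =>
  DifferentiableAt.comp (g := fun z' => M z' i j) w (hM i j) (hf.restrictScalars ℝ)

lemma matDel_comp {M : Cn n → Matrix (Fin m) (Fin p) ℂ} {f : Cn k → Cn n} {w : Cn k}
    (hM : MatDiffAt M (f w)) (hf : DifferentiableAt ℂ f w) (u : Cn k) :
    matDel (fun w' => M (f w')) w u = matDel M (f w) (fderiv ℂ f w u) := by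
  rw [matDel_eq, matDel_eq, matDeriv_comp hM hf, matDeriv_comp hM hf, map_smul]

section Inverse

variable {M : Cn k → Matrix (Fin m) (Fin m) ℂ} {z : Cn k}

lemma MatDiffAt.det (hM : MatDiffAt M z) : DifferentiableAt ℝ (fun z' => (M z').det) z := by
  simp only [Matrix.det_apply]
  refine DifferentiableAt.fun_sum fun σ _ => DifferentiableAt.fun_const_smul ?_ _
  exact (HasFDerivAt.finsetProd (g := fun i z' => M z' (σ i) i)
    fun i _ => (hM _ _).hasFDerivAt).differentiableAt

lemma MatDiffAt.adjugate (hM : MatDiffAt M z) : MatDiffAt (fun z' => (M z').adjugate) z := by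
  intro i j
  simp only [Matrix.adjugate_apply]
  refine MatDiffAt.det fun a b => ?_
  simp only [Matrix.updateRow_apply]
  split_ifs
  exacts [differentiableAt_const _, hM _ _]

lemma MatDiffAt.inv (hM : MatDiffAt M z) (hdet : IsUnit (M z).det) :
    MatDiffAt (fun z' => (M z')⁻¹) z := by
  intro i j
  simp only [Matrix.inv_def, Ring.inverse_eq_inv', Matrix.smul_apply, smul_eq_mul]
  exact (hM.det.inv hdet.ne_zero).mul (hM.adjugate i j)

lemma MatDiffAt.eventually_isUnit_det (hM : MatDiffAt M z) (hdet : IsUnit (M z).det) :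
    ∀ᶠ z' in 𝓝 z, IsUnit (M z').det := by
  filter_upwards [hM.det.continuousAt.eventually_ne hdet.ne_zero] with z' hz' using hz'.isUnit

lemma matDeriv_inv (hM : MatDiffAt M z) (hdet : IsUnit (M z).det) (u : Cn k) :
    matDeriv (fun z' => (M z')⁻¹) z u = -((M z)⁻¹ * matDeriv M z u * (M z)⁻¹) := by
  have h1 : (fun z' => (M z')⁻¹ * M z') =ᶠ[𝓝 z] fun _ => 1 := by
    filter_upwards [hM.eventually_isUnit_det hdet] with z' hz' using Matrix.nonsing_inv_mul _ hz'
  have h2 := matDeriv_congr h1 u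
  rw [matDeriv_mul (hM.inv hdet) hM, matDeriv_const] at h2
  have h3 := congrArg (· * (M z)⁻¹) h2
  simp only [Matrix.add_mul, Matrix.zero_mul, Matrix.mul_assoc, Matrix.mul_nonsing_inv _ hdet,
    Matrix.mul_one] at h3
  rw [Matrix.mul_assoc]
  exact eq_neg_of_add_eq_zero_left h3

end Inverse

/-- The curvature of a connection form `P dB` with `B` twice differentiable. -/
lemma curvature_mul_matDeriv {P : Cn k → Matrix (Fin m) (Fin n) ℂ}
    {B : Cn k → Matrix (Fin n) (Fin m) ℂ} {z : Cn k} (hP : MatDiffAt P z)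
    (hB : ∀ i j, ContDiffAt ℝ 2 (fun z' => B z' i j) z) (u v : Cn k) :
    ConnForm.curvature (fun z' u' => P z' * matDeriv B z' u') z u v =
      matDeriv P z u * matDeriv B z v - matDeriv P z v * matDeriv B z u
        + (P z * matDeriv B z u * (P z * matDeriv B z v)
          - P z * matDeriv B z v * (P z * matDeriv B z u)) := by
  have hd : ∀ i j, DifferentiableAt ℝ (fderiv ℝ (fun z' => B z' i j)) z := fun i j =>
    ((hB i j).fderiv_right (m := 1) (by norm_num)).differentiableAt (by norm_num)
  have hdB : ∀ v, MatDiffAt (fun z' => matDeriv B z' v) z := fun v i j => by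
    simp only [matDeriv, Matrix.of_apply]
    exact (hd i j).clm_apply (differentiableAt_const v)
  -- This is `d(dB) = 0`; only `dP ∧ dB` and the quadratic term survive.
  have hsymm : matDeriv (fun z' => matDeriv B z' v) z u
      = matDeriv (fun z' => matDeriv B z' u) z v := by
    ext i j
    simp only [matDeriv, Matrix.of_apply]
    rw [fderiv_clm_apply (hd i j) (differentiableAt_const v),
      fderiv_clm_apply (hd i j) (differentiableAt_const u)]
    simpa using ((hB i j).isSymmSndFDerivAt (by simp)) u v
  rw [curvature_eq]
  simp only [matDeriv_mul hP (hdB _), hsymm]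
  abel

end MatrixCalculus

/-! ### Jacobians of holomorphic maps -/

section Jacobian

variable {k n : ℕ}

/-- The Jacobian matrix of a holomorphic map. -/
noncomputable def jac (f : Cn k → Cn n) (w : Cn k) : Matrix (Fin n) (Fin k) ℂ :=
  Matrix.of fun i j => fderiv ℂ f w (basisVec j) i

lemma sum_smul_basisVec (v : Cn k) : ∑ j, v j • basisVec j = v := by
  ext i
  simp [basisVec, Finset.sum_apply, Pi.single_apply]

lemma matrix_of_mulVec (L : Cn k →L[ℂ] Cn n) (v : Cn k) :
    (Matrix.of fun i j => L (basisVec j) i) *ᵥ v.ofLp = (L v).ofLp := by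
  ext i
  conv_rhs => rw [← sum_smul_basisVec v, map_sum]
  simp [Matrix.mulVec, dotProduct, mul_comm]

lemma jac_mulVec (f : Cn k → Cn n) (w v : Cn k) :
    jac f w *ᵥ v.ofLp = (fderiv ℂ f w v).ofLp :=
  matrix_of_mulVec _ v

variable {f : Cn k → Cn n} {w : Cn k}

lemma contDiffAt_fderiv_complex (hf : ContDiffAt ℂ ω f w) : ContDiffAt ℂ ω (fderiv ℂ f) w :=
  hf.fderiv_right (by simp)

lemma contDiffAt_jac (hf : ContDiffAt ℂ ω f w) (i : Fin n) (j : Fin k) :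
    ContDiffAt ℂ ω (fun w' => jac f w' i j) w := by
  have h : ContDiffAt ℂ ω (fun w' => fderiv ℂ f w' (basisVec j)) w :=
    (contDiffAt_fderiv_complex hf).clm_apply contDiffAt_const
  exact ((EuclideanSpace.proj i : Cn n →L[ℂ] ℂ).contDiff.contDiffAt).comp w h

lemma matHolAt_jac (hf : ContDiffAt ℂ ω f w) : MatHolAt (jac f) w := fun i j =>
  (contDiffAt_jac hf i j).differentiableAt (by simp)

lemma contDiffAt_real_jac (hf : ContDiffAt ℂ ω f w) (i : Fin n) (j : Fin k) :
    ContDiffAt ℝ 2 (fun w' => jac f w' i j) w :=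
  ((contDiffAt_jac hf i j).restrict_scalars ℝ).of_le le_top

/-- The second differential of `f`, evaluated on vectors. -/
lemma fderiv_fderiv_apply (hf : ContDiffAt ℂ ω f w) (u v : Cn k) :
    fderiv ℝ (fun w' => fderiv ℂ f w' v) w u = fderiv ℂ (fderiv ℂ f) w u v := by
  have hd : DifferentiableAt ℂ (fderiv ℂ f) w :=
    (contDiffAt_fderiv_complex hf).differentiableAt (by simp)
  rw [(hd.clm_apply (differentiableAt_const v)).fderiv_restrictScalars ℝ,
    fderiv_clm_apply hd (differentiableAt_const v)]
  simp

lemma matDeriv_jac_mulVec (hf : ContDiffAt ℂ ω f w) (u v : Cn k) :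
    matDeriv (jac f) w u *ᵥ v.ofLp = (fderiv ℂ (fderiv ℂ f) w u v).ofLp := by
  have hd : DifferentiableAt ℂ (fderiv ℂ f) w :=
    (contDiffAt_fderiv_complex hf).differentiableAt (by simp)
  rw [← matrix_of_mulVec (fderiv ℂ (fderiv ℂ f) w u) v]
  congr 1
  ext i j
  simp only [matDeriv, Matrix.of_apply]
  rw [(matHolAt_jac hf i j).fderiv_restrictScalars ℝ]
  have h := ((EuclideanSpace.proj i : Cn n →L[ℂ] ℂ).hasFDerivAt).comp w
    (hd.clm_apply (differentiableAt_const (basisVec j))).hasFDerivAt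
  rw [fderiv_clm_apply hd (differentiableAt_const _)] at h
  have h' : fderiv ℂ (fun w' => jac f w' i j) w = _ := h.fderiv
  rw [ContinuousLinearMap.coe_restrictScalars', h']
  simp

lemma fderiv_fderiv_symm (hf : ContDiffAt ℂ ω f w) (u v : Cn k) :
    fderiv ℂ (fderiv ℂ f) w u v = fderiv ℂ (fderiv ℂ f) w v u :=
  (hf.isSymmSndFDerivAt (by simp)) u v

lemma jac_mulVec_injective (hinj : Function.Injective (fderiv ℂ f w)) :
    Function.Injective (jac f w).mulVec := by
  intro a b hab
  have h : fderiv ℂ f w (WithLp.toLp 2 a) = fderiv ℂ f w (WithLp.toLp 2 b) := by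
    apply WithLp.ofLp_injective
    rw [← jac_mulVec, ← jac_mulVec]
    exact hab
  simpa using congrArg WithLp.ofLp (hinj h)

end Jacobian

/-! ### Chern connections of pulled back metrics -/

section Pullback

variable {k n : ℕ}

/-- The matrix of the pull-back of a Hermitian metric by a holomorphic map. -/
noncomputable def pullbackMatrix (H : Cn n → Matrix (Fin n) (Fin n) ℂ) (f : Cn k → Cn n)
    (w : Cn k) : Matrix (Fin k) (Fin k) ℂ :=
  (jac f w)ᴴ * H (f w) * jac f w

variable {H : Cn n → Matrix (Fin n) (Fin n) ℂ} {f : Cn k → Cn n} {w : Cn k}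

lemma matDiffAt_pullbackMatrix (hf : ContDiffAt ℂ ω f w) (hH : MatDiffAt H (f w)) :
    MatDiffAt (pullbackMatrix H f) w :=
  ((matHolAt_jac hf).matDiffAt.conjTranspose.mul
    (hH.comp (hf.differentiableAt (by simp)))).mul (matHolAt_jac hf).matDiffAt

/-- The factor `Jᴴ` is antiholomorphic, so `∂` passes through it. -/
lemma matDel_pullbackMatrix (hf : ContDiffAt ℂ ω f w) (hH : MatDiffAt H (f w)) (u : Cn k) :
    matDel (pullbackMatrix H f) w u = (jac f w)ᴴ *
      (matDel H (f w) (fderiv ℂ f w u) * jac f w + H (f w) * matDeriv (jac f) w u) := by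
  have hB := matHolAt_jac hf
  have hf' := hf.differentiableAt (by simp)
  have h1 := matDel_mul (hB.matDiffAt.conjTranspose.mul (hH.comp hf')) hB.matDiffAt u
  rw [matDel_mul hB.matDiffAt.conjTranspose (hH.comp hf'), hB.matDel_conjTranspose,
    hB.matDel_eq_matDeriv, matDel_comp hH hf'] at h1
  refine h1.trans ?_
  simp only [Matrix.zero_mul, zero_add, Matrix.mul_add, Matrix.mul_assoc]

lemma posDef_pullbackMatrix (hH : (H (f w)).PosDef) (hinj : Function.Injective (fderiv ℂ f w)) :
    (pullbackMatrix H f w).PosDef :=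
  hH.conjTranspose_mul_mul_same (jac_mulVec_injective hinj)

lemma isUnit_det_of_posDef {m : ℕ} {M : Matrix (Fin m) (Fin m) ℂ} (hM : M.PosDef) :
    IsUnit M.det := (Matrix.isUnit_iff_isUnit_det _).1 hM.isUnit

/-- The Chern connection of the pull-back of a Kähler metric is torsion-free. -/
lemma act_chernForm_pullbackMatrix_symm (hf : ContDiffAt ℂ ω f w) (hH : MatDiffAt H (f w))
    (hsymm : ∀ u v : Cn n,
      matDel H (f w) u *ᵥ v.ofLp = matDel H (f w) v *ᵥ u.ofLp) (u v : Cn k) :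
    act (chernForm (pullbackMatrix H f) w u) v = act (chernForm (pullbackMatrix H f) w v) u := by
  -- Up to a left factor independent of `u` and `v`, the two sides are `∂H(df u)(df v) + H d²f(u,
  -- v)` and its swap, and both summands are symmetric.
  simp only [act, chernForm_eq, matDel_pullbackMatrix hf hH, ← Matrix.mulVec_mulVec,
    Matrix.add_mulVec, jac_mulVec, matDeriv_jac_mulVec hf, hsymm (fderiv ℂ f w u),
    fderiv_fderiv_symm hf u v]

/-- The Chern connection preserves the metric. -/
lemma matDeriv_eq_chernForm {m : ℕ} {h : Cn k → Matrix (Fin m) (Fin m) ℂ} {z : Cn k}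
    (hdet : IsUnit (h z).det) (hherm : ∀ᶠ z' in 𝓝 z, (h z').IsHermitian) (u : Cn k) :
    matDeriv h z u = h z * chernForm h z u + (chernForm h z u)ᴴ * h z := by
  -- Since `dh` is Hermitian on real tangent vectors, the adjoint of `∂h(u)` is `∂̄h(u)`, and the
  -- two add up to `dh(u)`.
  have h1 : ∀ u, (matDeriv h z u)ᴴ = matDeriv h z u := fun u => by
    rw [← matDeriv_conjTranspose]
    exact matDeriv_congr hherm u
  have h2 : (h z)ᴴ = h z := hherm.self_of_nhds
  rw [chernForm_eq, Matrix.conjTranspose_mul, Matrix.conjTranspose_nonsing_inv, h2,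
    Matrix.mul_nonsing_inv_cancel_left _ _ hdet, Matrix.nonsing_inv_mul_cancel_right _ _ hdet,
    matDel_eq]
  simp only [Matrix.conjTranspose_smul, Matrix.conjTranspose_sub, h1]
  simp
  module

/-- Transformation of the Chern connection under a holomorphic change of coordinates. -/
lemma chernForm_pullbackMatrix {f : Cn n → Cn n} {w : Cn n} (hf : ContDiffAt ℂ ω f w)
    (hH : MatDiffAt H (f w)) (hdet : IsUnit (H (f w)).det) (hJ : IsUnit (jac f w).det)
    (u : Cn n) :
    chernForm (pullbackMatrix H f) w u = (jac f w)⁻¹ *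
      (chernForm H (f w) (fderiv ℂ f w u) * jac f w + matDeriv (jac f) w u) := by
  have hJ' : IsUnit ((jac f w)ᴴ).det := by
    rw [Matrix.det_conjTranspose]
    exact hJ.star
  rw [chernForm_eq, chernForm_eq, matDel_pullbackMatrix hf hH, pullbackMatrix,
    Matrix.mul_inv_rev, Matrix.mul_inv_rev]
  simp only [Matrix.mul_assoc, Matrix.nonsing_inv_mul_cancel_left _ _ hJ', Matrix.mul_add,
    Matrix.nonsing_inv_mul_cancel_left _ _ hdet]

end Pullback

/-! ### Submanifolds of a flat Hermitian vector space -/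

section Gauss

variable {k n : ℕ} (H₀ : Matrix (Fin n) (Fin n) ℂ) (f : Cn k → Cn n) (w : Cn k)

/-- The orthogonal projection onto the tangent space of the image of `f`. -/
noncomputable def tangentProj : Matrix (Fin k) (Fin n) ℂ :=
  (pullbackMatrix (fun _ => H₀) f w)⁻¹ * (jac f w)ᴴ * H₀

/-- The metric of the normal bundle of the image of `f`, extended by zero to tangent vectors. -/
noncomputable def normalForm : Matrix (Fin n) (Fin n) ℂ :=
  H₀ - H₀ * jac f w * tangentProj H₀ f w

variable {H₀ f w}

lemma tangentProj_mul_jac (hH₀ : H₀.PosDef) (hinj : Function.Injective (fderiv ℂ f w)) :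
    tangentProj H₀ f w * jac f w = 1 := by
  have hdet := isUnit_det_of_posDef (posDef_pullbackMatrix (H := fun _ => H₀) hH₀ hinj)
  rw [← Matrix.nonsing_inv_mul _ hdet]
  simp only [tangentProj, pullbackMatrix, Matrix.mul_assoc]

lemma normalForm_mul_jac (hH₀ : H₀.PosDef) (hinj : Function.Injective (fderiv ℂ f w)) :
    normalForm H₀ f w * jac f w = 0 := by
  rw [normalForm, Matrix.sub_mul, Matrix.mul_assoc _ (tangentProj H₀ f w),
    tangentProj_mul_jac hH₀ hinj, Matrix.mul_one, sub_self]

/-- `J` times `tangentProj` is idempotent and self-adjoint for `H₀`, hence an orthogonal projection.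
The sandwiched form makes semipositivity, and the kernel, visible. -/
lemma normalForm_eq (hH₀ : H₀.PosDef) (hinj : Function.Injective (fderiv ℂ f w)) :
    normalForm H₀ f w = (1 - jac f w * tangentProj H₀ f w)ᴴ * H₀
      * (1 - jac f w * tangentProj H₀ f w) := by
  have hh := posDef_pullbackMatrix (H := fun _ => H₀) hH₀ hinj
  have h1 : (H₀ * (jac f w * tangentProj H₀ f w))ᴴ = H₀ * (jac f w * tangentProj H₀ f w) := by
    simp only [tangentProj, Matrix.conjTranspose_mul, Matrix.conjTranspose_nonsing_inv,
      Matrix.conjTranspose_conjTranspose, hH₀.isHermitian.eq, hh.isHermitian.eq, Matrix.mul_assoc]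
  have h2 : (jac f w * tangentProj H₀ f w)ᴴ * H₀ = H₀ * (jac f w * tangentProj H₀ f w) := by
    rw [← h1, Matrix.conjTranspose_mul H₀, hH₀.isHermitian.eq]
  have h3 : jac f w * tangentProj H₀ f w * (jac f w * tangentProj H₀ f w)
      = jac f w * tangentProj H₀ f w := by
    rw [Matrix.mul_assoc, ← Matrix.mul_assoc (tangentProj H₀ f w), tangentProj_mul_jac hH₀ hinj,
      Matrix.one_mul]
  rw [Matrix.conjTranspose_sub, Matrix.conjTranspose_one, Matrix.sub_mul _ _ H₀, h2,
    Matrix.one_mul, Matrix.mul_sub, Matrix.mul_one, Matrix.sub_mul, Matrix.mul_assoc H₀ _ (_ * _),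
    h3, sub_self, sub_zero, normalForm, Matrix.mul_assoc]

lemma posSemidef_normalForm (hH₀ : H₀.PosDef) (hinj : Function.Injective (fderiv ℂ f w)) :
    (normalForm H₀ f w).PosSemidef := by
  rw [normalForm_eq hH₀ hinj]
  exact hH₀.posSemidef.conjTranspose_mul_mul_same _

/-- A vector on which the normal metric vanishes is tangent. -/
lemma eq_jac_mulVec_of_normalForm (hH₀ : H₀.PosDef) (hinj : Function.Injective (fderiv ℂ f w))
    {x : Fin n → ℂ} (hx : star x ⬝ᵥ (normalForm H₀ f w *ᵥ x) = 0) :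
    x = jac f w *ᵥ (tangentProj H₀ f w *ᵥ x) := by
  by_contra hne
  have hy : (1 - jac f w * tangentProj H₀ f w) *ᵥ x ≠ 0 := by
    rwa [Matrix.sub_mulVec, Matrix.one_mulVec, ← Matrix.mulVec_mulVec, sub_ne_zero]
  have h := hH₀.dotProduct_mulVec_pos hy
  rw [normalForm_eq hH₀ hinj, ← Matrix.mulVec_mulVec, ← Matrix.mulVec_mulVec,
    Matrix.dotProduct_mulVec, ← Matrix.star_mulVec] at hx
  exact h.ne' hx

/-- For constant `H₀` only the derivative of `J` contributes: the induced connection is the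
tangential projection of the flat derivative. -/
lemma chernForm_pullback_const (hf : ContDiffAt ℂ ω f w) (u : Cn k) :
    chernForm (pullbackMatrix (fun _ => H₀) f) w u
      = tangentProj H₀ f w * matDeriv (jac f) w u := by
  have h0 : matDel (fun _ : Cn n => H₀) (f w) (fderiv ℂ f w u) = 0 := by
    simp [matDel_eq]
  rw [chernForm_eq, matDel_pullbackMatrix hf (matDiffAt_const _ _), h0, tangentProj]
  simp only [Matrix.zero_mul, zero_add, Matrix.mul_assoc]

/-- The Gauss equation for a complex submanifold of a flat Hermitian vector space. -/
lemma curvature_pullback_const (hf : ContDiffAt ℂ ω f w) (hH₀ : H₀.PosDef)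
    (hinj : Function.Injective (fderiv ℂ f w)) (u v : Cn k) :
    (chernForm (pullbackMatrix (fun _ => H₀) f)).curvature w u v =
      (pullbackMatrix (fun _ => H₀) f w)⁻¹ *
        ((matDeriv (jac f) w u)ᴴ * normalForm H₀ f w * matDeriv (jac f) w v
          - (matDeriv (jac f) w v)ᴴ * normalForm H₀ f w * matDeriv (jac f) w u) := by
  have hdet := isUnit_det_of_posDef (posDef_pullbackMatrix (H := fun _ => H₀) hH₀ hinj)
  have hB := (matHolAt_jac hf).matDiffAt
  have hh : MatDiffAt (pullbackMatrix (fun _ => H₀) f) w :=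
    matDiffAt_pullbackMatrix hf (matDiffAt_const _ _)
  have hdh : ∀ u, matDeriv (pullbackMatrix (fun _ => H₀) f) w u =
      (matDeriv (jac f) w u)ᴴ * H₀ * jac f w + (jac f w)ᴴ * H₀ * matDeriv (jac f) w u := by
    intro u
    have h1 := matDeriv_mul (hB.conjTranspose.mul (matDiffAt_const H₀ w)) hB u
    rw [matDeriv_mul hB.conjTranspose (matDiffAt_const H₀ w), matDeriv_conjTranspose,
      matDeriv_const, Matrix.mul_zero, add_zero] at h1
    exact h1
  have hP : MatDiffAt (tangentProj H₀ f) w :=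
    ((hh.inv hdet).mul hB.conjTranspose).mul (matDiffAt_const H₀ w)
  have hdP : ∀ u, matDeriv (tangentProj H₀ f) w u =
      -((pullbackMatrix (fun _ => H₀) f w)⁻¹ * ((matDeriv (jac f) w u)ᴴ * H₀ * jac f w
        + (jac f w)ᴴ * H₀ * matDeriv (jac f) w u) * tangentProj H₀ f w)
      + (pullbackMatrix (fun _ => H₀) f w)⁻¹ * (matDeriv (jac f) w u)ᴴ * H₀ := by
    intro u
    have h1 := matDeriv_mul ((hh.inv hdet).mul hB.conjTranspose) (matDiffAt_const H₀ w) u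
    rw [matDeriv_mul (hh.inv hdet) hB.conjTranspose, matDeriv_conjTranspose, matDeriv_inv hh hdet,
      matDeriv_const, Matrix.mul_zero, add_zero, hdh] at h1
    refine h1.trans ?_
    simp only [tangentProj, Matrix.add_mul, Matrix.neg_mul, Matrix.mul_assoc]
  have hev : ∀ᶠ w' in 𝓝 w, ∀ u, chernForm (pullbackMatrix (fun _ => H₀) f) w' u
      = tangentProj H₀ f w' * matDeriv (jac f) w' u := by
    filter_upwards [hf.eventually (by simp)] with w' hw' u using chernForm_pullback_const hw' u
  -- In `dP ∧ dJ`, the part of `d(h⁻¹)` that differentiates the right factor `J` of `h` cancels `A ∧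
  -- A`; the part that differentiates `Jᴴ` combines with the derivative of `Jᴴ` in `P` to give `N`.
  rw [curvature_congr hev, curvature_mul_matDeriv hP (contDiffAt_real_jac hf), hdP, hdP,
    normalForm]
  simp only [tangentProj, Matrix.add_mul, Matrix.mul_add, Matrix.neg_mul, Matrix.mul_sub,
    Matrix.sub_mul, Matrix.mul_assoc]
  abel

/-- `dJ` is complex linear in the direction. Passing to the `(1,0)`-part of `u` and the `(0,1)`-part
of `v` therefore removes the term antilinear in `u` and keeps the one antilinear in `v`. -/
lemma curvatureMixed_pullback_const (hf : ContDiffAt ℂ ω f w) (hH₀ : H₀.PosDef)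
    (hinj : Function.Injective (fderiv ℂ f w)) (u v : Cn k) :
    (chernForm (pullbackMatrix (fun _ => H₀) f)).curvatureMixed w u v =
      -((pullbackMatrix (fun _ => H₀) f w)⁻¹ *
        ((matDeriv (jac f) w v)ᴴ * normalForm H₀ f w * matDeriv (jac f) w u)) := by
  have hI := (matHolAt_jac hf).matDeriv_smul Complex.I
  simp only [ConnForm.curvatureMixed, curvature_pullback_const hf hH₀ hinj, hI,
    Matrix.conjTranspose_smul, Matrix.smul_mul, Matrix.mul_smul, Matrix.mul_sub, smul_sub,
    smul_smul, Complex.star_def, Complex.conj_I, Complex.I_mul_I, mul_neg, neg_neg]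
  module

end Gauss

/-! ### Positivity -/

section Positivity

variable {k n : ℕ}

/-- For `x = a + ib` the cross terms cancel by symmetry of `A`, leaving `aᵀAa + bᵀAb`. -/
lemma posDef_map_ofReal {A : Matrix (Fin n) (Fin n) ℝ} (hA : A.PosDef) :
    (A.map Complex.ofReal).PosDef := by
  have hsymm : Aᵀ = A := by simpa using hA.isHermitian.eq
  refine Matrix.PosDef.of_dotProduct_mulVec_pos ?_ fun x hx => ?_
  · ext i j
    have h := congrFun (congrFun hsymm i) j
    simp only [Matrix.transpose_apply] at h
    simp [h]
  set a : Fin n → ℝ := fun i => (x i).re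
  set b : Fin n → ℝ := fun i => (x i).im
  have hcross : a ⬝ᵥ (A *ᵥ b) = b ⬝ᵥ (A *ᵥ a) := by
    rw [Matrix.dotProduct_mulVec, ← Matrix.mulVec_transpose, hsymm, dotProduct_comm]
  have hre : star x ⬝ᵥ (A.map Complex.ofReal *ᵥ x)
      = ((a ⬝ᵥ (A *ᵥ a) + b ⬝ᵥ (A *ᵥ b) : ℝ) : ℂ) := by
    apply Complex.ext
    · simp only [dotProduct, Matrix.mulVec, Pi.star_apply, Complex.star_def, Matrix.map_apply,
        Complex.re_sum, Complex.im_sum, Complex.mul_re, Complex.mul_im, Complex.conj_re,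
        Complex.conj_im, Complex.ofReal_re, Complex.ofReal_im, zero_mul, sub_zero, add_zero,
        neg_mul, sub_neg_eq_add, Finset.sum_add_distrib, a, b]
    · have h : (star x ⬝ᵥ (A.map Complex.ofReal *ᵥ x)).im
          = a ⬝ᵥ (A *ᵥ b) - b ⬝ᵥ (A *ᵥ a) := by
        simp only [dotProduct, Matrix.mulVec, Pi.star_apply, Complex.star_def, Matrix.map_apply,
          Complex.re_sum, Complex.im_sum, Complex.mul_re, Complex.mul_im, Complex.conj_re,
          Complex.conj_im, Complex.ofReal_re, Complex.ofReal_im, zero_mul, sub_zero, add_zero,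
          neg_mul, ← sub_eq_add_neg, Finset.sum_sub_distrib, a, b]
      rw [h, hcross, sub_self, Complex.ofReal_im]
  rw [hre, Complex.zero_lt_real]
  have hnn : ∀ y : Fin n → ℝ, 0 ≤ y ⬝ᵥ (A *ᵥ y) := fun y => by
    simpa using hA.posSemidef.dotProduct_mulVec_nonneg y
  have hpos : ∀ y : Fin n → ℝ, y ≠ 0 → 0 < y ⬝ᵥ (A *ᵥ y) := fun y hy => by
    simpa using hA.dotProduct_mulVec_pos hy
  by_cases ha : a = 0
  · have hb : b ≠ 0 := by
      rintro hb
      refine hx (funext fun i => Complex.ext ?_ ?_)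
      exacts [congrFun ha i, congrFun hb i]
    linarith [hnn a, hpos b hb]
  · linarith [hpos a ha, hnn b]

open scoped MatrixOrder in
-- Factor `A = CᴴC`; by cyclicity the trace is that of `C M Cᴴ`.
lemma trace_mul_nonneg {A M : Matrix (Fin k) (Fin k) ℂ} (hA : A.PosSemidef)
    (hM : M.PosSemidef) : 0 ≤ (A * M).trace := by
  obtain ⟨C, rfl⟩ := CStarAlgebra.nonneg_iff_eq_star_mul_self.mp hA.nonneg
  rw [Matrix.star_eq_conjTranspose, Matrix.mul_assoc, Matrix.trace_mul_comm]
  exact (hM.mul_mul_conjTranspose_same C).trace_nonneg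

lemma sum_conjTranspose_mul_mul (N : Matrix (Fin n) (Fin n) ℂ)
    (β γ : Matrix (Fin n) (Fin k) ℂ) (a b : Fin k → ℂ) :
    ∑ i, ∑ j, (γᴴ * N * β) j i * a i * conj (b j) = star (γ *ᵥ b) ⬝ᵥ (N *ᵥ (β *ᵥ a)) := by
  have h : star (γ *ᵥ b) ⬝ᵥ (N *ᵥ (β *ᵥ a)) = star b ⬝ᵥ ((γᴴ * N * β) *ᵥ a) := by
    rw [Matrix.star_mulVec, ← Matrix.dotProduct_mulVec, Matrix.mulVec_mulVec,
      Matrix.mulVec_mulVec, Matrix.mul_assoc]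
  rw [h, Finset.sum_comm]
  simp only [dotProduct, Matrix.mulVec, Finset.mul_sum, Pi.star_apply, Complex.star_def]
  exact Finset.sum_congr rfl fun j _ => Finset.sum_congr rfl fun i _ => by ring

/-- The sum is the `N`-norm squared of the single vector `∑ β_i u_i`. -/
lemma sum_nakano_nonneg {N : Matrix (Fin n) (Fin n) ℂ} (hN : N.PosSemidef)
    (β : Fin k → Matrix (Fin n) (Fin k) ℂ) (u : Fin k → Fin k → ℂ) :
    0 ≤ ∑ i, ∑ j, ∑ a, ∑ b, ((β j)ᴴ * N * β i) b a * u i a * conj (u j b) := by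
  simp only [sum_conjTranspose_mul_mul]
  have h := hN.dotProduct_mulVec_nonneg (∑ i, β i *ᵥ u i)
  rw [star_sum, Matrix.mulVec_sum, sum_dotProduct] at h
  simp only [dotProduct_sum] at h
  rwa [Finset.sum_comm] at h

/-- By sesquilinearity the sum is the trace of `A * (Bᴴ N B)` with `B = ∑ u_i β_i`. -/
lemma sum_trace_nonneg {N : Matrix (Fin n) (Fin n) ℂ} (hN : N.PosSemidef)
    {A : Matrix (Fin k) (Fin k) ℂ} (hA : A.PosSemidef)
    (β : Fin k → Matrix (Fin n) (Fin k) ℂ) (u : Fin k → ℂ) :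
    0 ≤ ∑ i, ∑ j, (A * ((β j)ᴴ * N * β i)).trace * u i * conj (u j) := by
  have h := trace_mul_nonneg hA (hN.conjTranspose_mul_mul_same (∑ i, u i • β i))
  convert h using 1
  simp only [Matrix.conjTranspose_sum, Matrix.conjTranspose_smul, Finset.mul_sum,
    Matrix.trace_sum, Matrix.sum_mul, Matrix.mul_sum, Matrix.smul_mul,
    Matrix.mul_smul, Matrix.trace_smul, smul_eq_mul, Complex.star_def]
  exact Finset.sum_congr rfl fun i _ => Finset.sum_congr rfl fun j _ => by ring

/-- Apply the Nakano inequality to the decomposable tensor `uⁱ vᵃ`. -/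
lemma NakanoNonpos.bisectionalNonpos {X : Type*} [TopologicalSpace X] [ChartedSpace (Cn n) X]
    {g : TangentPairing n X} (hg : NakanoNonpos g) : BisectionalNonpos g := by
  intro e he z hz u v
  refine le_of_eq_of_le ?_ (hg e he z hz fun i a => u i * v a)
  simp only [map_mul]
  refine Finset.sum_congr rfl fun i _ => Finset.sum_congr rfl fun j _ => ?_
  exact Finset.sum_congr rfl fun a _ => Finset.sum_congr rfl fun b _ => by ring

end Positivity

/-! ### Maps in charts -/

section Charts

lemma inCharts_mem_target {n s : ℕ} {X S : Type*} [TopologicalSpace X] [TopologicalSpace S]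
    {ι : S → X} {d : OpenPartialHomeomorph S (Cn s)} {e : OpenPartialHomeomorph X (Cn n)}
    {w : Cn s} (hwe : ι (d.symm w) ∈ e.source) :
    inCharts ι d e w ∈ e.target :=
  e.map_source hwe

lemma eventually_mem_charts {n s : ℕ} {X S : Type*} [TopologicalSpace X] [TopologicalSpace S]
    {ι : S → X} {d : OpenPartialHomeomorph S (Cn s)} {e : OpenPartialHomeomorph X (Cn n)}
    {w : Cn s} (hι : Continuous ι) (hw : w ∈ d.target)
    (hwe : ι (d.symm w) ∈ e.source) :
    ∀ᶠ w' in 𝓝 w, w' ∈ d.target ∧ ι (d.symm w') ∈ e.source := by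
  refine Filter.Eventually.and (d.open_target.mem_nhds hw) ?_
  have h : ContinuousAt (fun w' => ι (d.symm w')) w :=
    hι.continuousAt.comp (d.continuousAt_symm hw)
  exact h.eventually (e.open_source.mem_nhds hwe)

lemma inCharts_eventuallyEq_comp {n s : ℕ} {X S : Type*} [TopologicalSpace X] [TopologicalSpace S]
    {ι : S → X} {d : OpenPartialHomeomorph S (Cn s)} {e : OpenPartialHomeomorph X (Cn n)}
    {w : Cn s}
    {e' : OpenPartialHomeomorph X (Cn n)} (hι : Continuous ι) (hw : w ∈ d.target)
    (hwe : ι (d.symm w) ∈ e.source) :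
    inCharts ι d e' =ᶠ[𝓝 w] fun w' => inCharts id e e' (inCharts ι d e w') := by
  filter_upwards [eventually_mem_charts hι hw hwe] with w' hw'
  simp [inCharts, e.left_inv hw'.2]

variable {n s : ℕ} {X : Type*} [TopologicalSpace X] [ChartedSpace (Cn n) X]
  {S : Type*} [TopologicalSpace S] [ChartedSpace (Cn s) S]
  {ι : S → X} {d : OpenPartialHomeomorph S (Cn s)} {e : OpenPartialHomeomorph X (Cn n)}
  {w : Cn s}

lemma contMDiffAt_inCharts (hι : ContMDiff 𝓘(ℂ, Cn s) 𝓘(ℂ, Cn n) ω ι) (hd : d ∈ holCharts s S)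
    (he : e ∈ holCharts n X) (hw : w ∈ d.target) (hwe : ι (d.symm w) ∈ e.source) :
    ContDiffAt ℂ ω (inCharts ι d e) w := by
  rw [← contMDiffAt_iff_contDiffAt]
  have h1 := contMDiffAt_symm_of_mem_maximalAtlas hd hw
  have h2 : ContMDiffAt 𝓘(ℂ, Cn n) 𝓘(ℂ, Cn n) ω e (ι (d.symm w)) :=
    contMDiffAt_of_mem_maximalAtlas he hwe
  exact h2.comp w ((hι (d.symm w)).comp w h1)

lemma fderiv_inCharts (hι : ContMDiff 𝓘(ℂ, Cn s) 𝓘(ℂ, Cn n) ω ι) (hd : d ∈ holCharts s S)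
    (he : e ∈ holCharts n X) (hw : w ∈ d.target) (hwe : ι (d.symm w) ∈ e.source) (v : Cn s) :
    fderiv ℂ (inCharts ι d e) w v =
      mfderiv 𝓘(ℂ, Cn n) 𝓘(ℂ, Cn n) e (ι (d.symm w))
        (mfderiv 𝓘(ℂ, Cn s) 𝓘(ℂ, Cn n) ι (d.symm w)
          (mfderiv 𝓘(ℂ, Cn s) 𝓘(ℂ, Cn s) d.symm w v)) := by
  have h1 := (contMDiffAt_symm_of_mem_maximalAtlas hd hw).mdifferentiableAt (by simp)
  have h2 : MDifferentiableAt 𝓘(ℂ, Cn n) 𝓘(ℂ, Cn n) e (ι (d.symm w)) :=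
    (contMDiffAt_of_mem_maximalAtlas (n := ω) he hwe).mdifferentiableAt (by simp)
  have h3 := (hι (d.symm w)).mdifferentiableAt (by simp)
  have h4 := h2.hasMFDerivAt.comp w (h3.hasMFDerivAt.comp w h1.hasMFDerivAt)
  have h5 : mfderiv 𝓘(ℂ, Cn s) 𝓘(ℂ, Cn n) (inCharts ι d e) w = _ := h4.mfderiv
  rw [← mfderiv_eq_fderiv, h5]
  rfl

lemma mdifferentiable_of_mem_holCharts (he : e ∈ holCharts n X) :
    e.MDifferentiable 𝓘(ℂ, Cn n) 𝓘(ℂ, Cn n) :=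
  ⟨(contMDiffOn_of_mem_maximalAtlas he).mdifferentiableOn (by simp),
    (contMDiffOn_symm_of_mem_maximalAtlas he).mdifferentiableOn (by simp)⟩

lemma fderiv_inCharts_injective [IsManifold 𝓘(ℂ, Cn n) ω X] [IsManifold 𝓘(ℂ, Cn s) ω S]
    (hι : ContMDiff 𝓘(ℂ, Cn s) 𝓘(ℂ, Cn n) ω ι)
    (hinj : ∀ x, Function.Injective (mfderiv 𝓘(ℂ, Cn s) 𝓘(ℂ, Cn n) ι x)) (hd : d ∈ holCharts s S)
    (he : e ∈ holCharts n X) (hw : w ∈ d.target) (hwe : ι (d.symm w) ∈ e.source) :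
    Function.Injective (fderiv ℂ (inCharts ι d e) w) := by
  have : IsManifold 𝓘(ℂ, Cn n) 1 X := .of_le (n := ω) le_top
  have : IsManifold 𝓘(ℂ, Cn s) 1 S := .of_le (n := ω) le_top
  have h1 := (mdifferentiable_of_mem_holCharts he).mfderiv_injective hwe
  have h2 := (mdifferentiable_of_mem_holCharts hd).symm.mfderiv_injective (x := w) hw
  intro a b hab
  rw [fderiv_inCharts hι hd he hw hwe, fderiv_inCharts hι hd he hw hwe] at hab
  exact h2 (hinj _ (h1 hab))

/-- The differential of an immersion is injective. -/
lemma mfderiv_injective_of_isImmersion [IsManifold 𝓘(ℂ, Cn n) ω X] [IsManifold 𝓘(ℂ, Cn s) ω S]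
    (hι : Manifold.IsImmersion 𝓘(ℂ, Cn s) 𝓘(ℂ, Cn n) ω ι) (x : S) :
    Function.Injective (mfderiv 𝓘(ℂ, Cn s) 𝓘(ℂ, Cn n) ι x) := by
  have : IsManifold 𝓘(ℂ, Cn n) 1 X := .of_le (n := ω) le_top
  have : IsManifold 𝓘(ℂ, Cn s) 1 S := .of_le (n := ω) le_top
  have h := hι.isImmersionAt x
  set d := h.domChart
  set e := h.codChart
  have hd : d ∈ holCharts s S := h.domChart_mem_maximalAtlas
  have he : e ∈ holCharts n X := h.codChart_mem_maximalAtlas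
  have hx : x ∈ d.source := h.mem_domChart_source
  have hw : d x ∈ d.target := d.map_source hx
  have hdx : d.symm (d x) = x := d.left_inv hx
  have hwe : ι (d.symm (d x)) ∈ e.source := by rw [hdx]; exact h.mem_codChart_source
  -- In the charts adapted to the immersion, the map is the linear inclusion `w ↦ (w, 0)`.
  have heq : inCharts ι d e =ᶠ[𝓝 (d x)] fun w => h.equiv (w, 0) := by
    filter_upwards [d.open_target.mem_nhds hw] with w hw
    exact h.writtenInCharts (by simpa using hw)
  have hfd : ∀ v, fderiv ℂ (inCharts ι d e) (d x) v = h.equiv (v, 0) := by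
    intro v
    have h1 : HasFDerivAt (fun w => h.equiv (w, 0))
        ((h.equiv : (Cn s × h.complement) →L[ℂ] Cn n).comp (ContinuousLinearMap.inl ℂ _ _))
        (d x) := ContinuousLinearMap.hasFDerivAt
          ((h.equiv : (Cn s × h.complement) →L[ℂ] Cn n).comp (ContinuousLinearMap.inl ℂ _ _))
    rw [heq.fderiv_eq, h1.fderiv]
    simp
  have hsurj := (mdifferentiable_of_mem_holCharts hd).symm.mfderiv_surjective (x := d x) hw
  have key : Function.Injective (mfderiv 𝓘(ℂ, Cn s) 𝓘(ℂ, Cn n) ι (d.symm (d x))) := by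
    intro a b hab
    obtain ⟨a, rfl⟩ := hsurj a
    obtain ⟨b, rfl⟩ := hsurj b
    have h2 := (hfd a).symm.trans ((fderiv_inCharts hι.contMDiff hd he hw hwe a).trans
      ((congrArg _ hab).trans ((fderiv_inCharts hι.contMDiff hd he hw hwe b).symm.trans (hfd b))))
    have h3 : a = b := congrArg Prod.fst (h.equiv.injective h2)
    rw [h3]
  rwa [hdx] at key

end Charts

/-! ### The metric in special coordinates -/

namespace SpecialChart

variable {r : ℕ} {X : Type*} [TopologicalSpace X] [ChartedSpace (Cn r) X]

/-- The matrix `Im τ` as a function of the special coordinates. -/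
noncomputable def imHessian (c : SpecialChart r X) (z : Cn r) : Matrix (Fin r) (Fin r) ℂ :=
  ((hessian c.F z).map Complex.im).map Complex.ofReal

variable (c : SpecialChart r X) {z : Cn r}

lemma posDef_imHessian (hz : z ∈ c.a.target) : (c.imHessian z).PosDef :=
  posDef_map_ofReal (c.posDef z hz)

/-- The Kähler condition involves third derivatives of `F`, hence two of its gradient. -/
lemma contDiffAt_gradient (hz : z ∈ c.a.target) (i : Fin r) :
    ContDiffAt ℂ 2 (fun z' => gradient c.F z' i) z := by
  have h : ContDiffAt ℂ 3 c.F z :=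
    (contDiffOn_of_differentiableOn c.a.open_target 3 c.holomorphic).contDiffAt
      (c.a.open_target.mem_nhds hz)
  exact (h.fderiv_right (m := 2) (by norm_num)).clm_apply contDiffAt_const

lemma differentiableAt_hessian (hz : z ∈ c.a.target) : MatHolAt (hessian c.F) z := by
  intro i j
  have h := ((c.contDiffAt_gradient hz i).fderiv_right (m := 1) (by norm_num)).differentiableAt
    (by norm_num)
  exact h.clm_apply (differentiableAt_const (basisVec j))

lemma hasFDerivAt_imHessian (hz : z ∈ c.a.target) (i j : Fin r) :
    HasFDerivAt (fun z' => c.imHessian z' i j)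
      ((Complex.ofRealCLM.comp Complex.imCLM).comp
        ((fderiv ℂ (fun z' => hessian c.F z' i j) z).restrictScalars ℝ)) z :=
  (Complex.ofRealCLM.comp Complex.imCLM).hasFDerivAt.comp z
    ((c.differentiableAt_hessian hz i j).hasFDerivAt.restrictScalars ℝ)

lemma matDiffAt_imHessian (hz : z ∈ c.a.target) : MatDiffAt c.imHessian z := fun i j =>
  (c.hasFDerivAt_imHessian hz i j).differentiableAt

/-- `Im τ = (τ - τ̄) / (2i)` and `∂τ̄ = 0`; the constant is `1 / (2i) = -i / 2`. -/
lemma matDel_imHessian (hz : z ∈ c.a.target) (u : Cn r) :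
    matDel c.imHessian z u = (-Complex.I / 2) • matDeriv (hessian c.F) z u := by
  ext i j
  simp only [matDel, matDeriv, del, Matrix.of_apply, Matrix.smul_apply,
    (c.hasFDerivAt_imHessian hz i j).fderiv,
    (c.differentiableAt_hessian hz i j).fderiv_restrictScalars ℝ]
  set t := fderiv ℂ (fun z' => hessian c.F z' i j) z u with ht
  apply Complex.ext <;> simp [← ht] <;> ring

lemma matDeriv_hessian_mulVec (hz : z ∈ c.a.target) (u v : Cn r) (i : Fin r) :
    (matDeriv (hessian c.F) z u *ᵥ v.ofLp) i
      = fderiv ℂ (fderiv ℂ (fun z' => gradient c.F z' i)) z u v := by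
  have h := ((c.contDiffAt_gradient hz i).fderiv_right (m := 1) (by norm_num)).differentiableAt
    (by norm_num)
  conv_rhs => rw [← sum_smul_basisVec v, map_sum]
  simp only [Matrix.mulVec, dotProduct, matDeriv, Matrix.of_apply, map_smul, smul_eq_mul]
  refine Finset.sum_congr rfl fun j _ => ?_
  rw [(c.differentiableAt_hessian hz i j).fderiv_restrictScalars ℝ, mul_comm]
  have h1 : fderiv ℂ (fun z' => hessian c.F z' i j) z = _ :=
    fderiv_clm_apply h (differentiableAt_const (basisVec j))
  rw [ContinuousLinearMap.coe_restrictScalars', h1]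
  simp

/-- The Kähler condition for `Im τ`. -/
lemma matDel_imHessian_symm (hz : z ∈ c.a.target) (u v : Cn r) :
    matDel c.imHessian z u *ᵥ v.ofLp = matDel c.imHessian z v *ᵥ u.ofLp := by
  rw [c.matDel_imHessian hz, c.matDel_imHessian hz, Matrix.smul_mulVec, Matrix.smul_mulVec]
  congr 1
  ext i
  rw [c.matDeriv_hessian_mulVec hz, c.matDeriv_hessian_mulVec hz]
  exact ((c.contDiffAt_gradient hz i).isSymmSndFDerivAt (by simp)) u v

end SpecialChart

/-! ### Induced metrics of special Kähler manifolds -/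

section Induced

variable {r s : ℕ} {X : Type*} [TopologicalSpace X] [ChartedSpace (Cn r) X]
  {S : Type*} [TopologicalSpace S] [ChartedSpace (Cn s) S]
  {K : SpecialKahlerStructure r X} {c : SpecialChart r X}
  {ι : S → X} {d : OpenPartialHomeomorph S (Cn s)} {e : OpenPartialHomeomorph X (Cn r)}
  {w : Cn s}

lemma metricMatrix_inducedMetric (hι : ContMDiff 𝓘(ℂ, Cn s) 𝓘(ℂ, Cn r) ω ι)
    (hd : d ∈ holCharts s S) (hc : c ∈ K.charts) (hw : w ∈ d.target)
    (hwc : ι (d.symm w) ∈ c.a.source) :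
    metricMatrix (inducedMetric (s := s) K.metric ι) d w
      = pullbackMatrix c.imHessian (inCharts ι d c.a) w := by
  have hpos := (c.posDef_imHessian (inCharts_mem_target hwc)).isHermitian
  ext l k
  have hda : ∀ j i, c.da (ι (d.symm w)) (mfderiv 𝓘(ℂ, Cn s) 𝓘(ℂ, Cn r) ι (d.symm w)
      (coordField d w j)) i = jac (inCharts ι d c.a) w i j := fun j i =>
    congrArg (fun v : Cn r => v i)
      (fderiv_inCharts hι hd c.a_mem hw hwc (basisVec j)).symm
  -- `metricMatrix` puts the antilinear index first, whereas the special Kähler formula puts it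
  -- second; symmetry of `Im τ` reconciles them.
  have hH : ∀ i j, ((c.periodMatrix (ι (d.symm w)) i j).im : ℂ)
      = c.imHessian (inCharts ι d c.a w) j i := fun i j => by
    rw [← hpos.apply]
    simp [SpecialChart.imHessian, SpecialChart.periodMatrix, inCharts]
  simp only [metricMatrix, Matrix.of_apply, inducedMetric, K.metric_eq c hc _ hwc, hda, hH,
    pullbackMatrix, Matrix.mul_apply, Matrix.conjTranspose_apply, Finset.sum_mul,
    Complex.star_def]
  exact Finset.sum_congr rfl fun i _ => Finset.sum_congr rfl fun j _ => by ring

lemma metricMatrix_inducedMetric_eventuallyEq (hι : ContMDiff 𝓘(ℂ, Cn s) 𝓘(ℂ, Cn r) ω ι)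
    (hd : d ∈ holCharts s S) (hc : c ∈ K.charts) (hw : w ∈ d.target)
    (hwc : ι (d.symm w) ∈ c.a.source) :
    metricMatrix (inducedMetric (s := s) K.metric ι) d
      =ᶠ[𝓝 w] pullbackMatrix c.imHessian (inCharts ι d c.a) := by
  filter_upwards [eventually_mem_charts hι.continuous hw hwc] with w' hw'
  exact metricMatrix_inducedMetric hι hd hc hw'.1 hw'.2

/-- Regarding `X` as a submanifold of itself makes the ambient statements, including changes of
chart, the case `ι = id` of those on submanifolds. -/
lemma inducedMetric_id (g : TangentPairing r X) : inducedMetric (s := r) g id = g := by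
  funext x u v
  simp [inducedMetric]

variable [IsManifold 𝓘(ℂ, Cn r) ω X] [IsManifold 𝓘(ℂ, Cn s) ω S]

/-- Complex submanifolds of special Kähler manifolds are Kähler. -/
theorem chernIsLeviCivita_inducedMetric (K : SpecialKahlerStructure r X)
    (hι : Manifold.IsImmersion 𝓘(ℂ, Cn s) 𝓘(ℂ, Cn r) ω ι) :
    ChernIsLeviCivita (inducedMetric (s := s) K.metric ι) := by
  intro d hd w hw u v
  obtain ⟨c, hc, hwc⟩ := K.cover (ι (d.symm w))
  have hev := metricMatrix_inducedMetric_eventuallyEq hι.contMDiff hd hc hw hwc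
  have hf := contMDiffAt_inCharts hι.contMDiff hd c.a_mem hw hwc
  have hz := inCharts_mem_target hwc
  have hpos : ∀ᶠ w' in 𝓝 w,
      (metricMatrix (inducedMetric (s := s) K.metric ι) d w').PosDef := by
    filter_upwards [hev, eventually_mem_charts hι.contMDiff.continuous hw hwc] with w' h1 h2
    rw [h1]
    exact posDef_pullbackMatrix (c.posDef_imHessian (inCharts_mem_target h2.2))
      (fderiv_inCharts_injective hι.contMDiff (mfderiv_injective_of_isImmersion hι) hd c.a_mem
        h2.1 h2.2)
  constructor
  · simp only [chernConn, chernForm_congr hev]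
    exact act_chernForm_pullbackMatrix_symm hf (c.matDiffAt_imHessian hz)
      (c.matDel_imHessian_symm hz) u v
  · intro i j
    exact congrFun (congrFun (matDeriv_eq_chernForm (isUnit_det_of_posDef hpos.self_of_nhds)
      (hpos.mono fun _ h => h.isHermitian) u) i) j

theorem chernIsLeviCivita_metric (K : SpecialKahlerStructure r X) :
    ChernIsLeviCivita K.metric := by
  have h := chernIsLeviCivita_inducedMetric (ι := (id : X → X)) K Manifold.IsImmersion.id
  rwa [inducedMetric_id] at h

lemma isUnit_det_jac_transition {z : Cn r} (he : e ∈ holCharts r X) (hz : z ∈ e.target)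
    (hzc : e.symm z ∈ c.a.source) : IsUnit (jac (inCharts id e c.a) z).det := by
  have hinj := jac_mulVec_injective (fderiv_inCharts_injective (ι := (id : X → X)) contMDiff_id
    (mfderiv_injective_of_isImmersion Manifold.IsImmersion.id) he c.a_mem hz hzc)
  exact (Matrix.isUnit_iff_isUnit_det _).1 (Matrix.mulVec_injective_iff_isUnit.1 hinj)

/-- The Chern connection in an arbitrary chart, in terms of special coordinates. -/
lemma chernConn_eq {z : Cn r} (hc : c ∈ K.charts) (he : e ∈ holCharts r X) (hz : z ∈ e.target)
    (hzc : e.symm z ∈ c.a.source) (u : Cn r) :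
    chernConn K.metric e z u = (jac (inCharts id e c.a) z)⁻¹ *
      (chernForm c.imHessian (inCharts id e c.a z) (fderiv ℂ (inCharts id e c.a) z u)
        * jac (inCharts id e c.a) z + matDeriv (jac (inCharts id e c.a)) z u) := by
  have hev := metricMatrix_inducedMetric_eventuallyEq (K := K) (ι := (id : X → X)) contMDiff_id
    he hc hz hzc
  rw [inducedMetric_id] at hev
  have ht : inCharts id e c.a z ∈ c.a.target := inCharts_mem_target hzc
  rw [chernConn, chernForm_congr hev]
  exact chernForm_pullbackMatrix (contMDiffAt_inCharts contMDiff_id he c.a_mem hz hzc)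
    (c.matDiffAt_imHessian ht) (isUnit_det_of_posDef (c.posDef_imHessian ht))
    (isUnit_det_jac_transition he hz hzc) u

end Induced

/-! ### Fibers of the period map -/

section Fiber

variable {r s : ℕ} {X : Type*} [TopologicalSpace X] [ChartedSpace (Cn r) X]
  {S : Type*} [TopologicalSpace S]
  {K : SpecialKahlerStructure r X} {c : SpecialChart r X}
  {ι : S → X} {d : OpenPartialHomeomorph S (Cn s)} {e : OpenPartialHomeomorph X (Cn r)}
  {w : Cn s} {τ : X → SiegelSpace r} {τ₀ : SiegelSpace r}

/-- The imaginary part of a point of Siegel's upper half-space. -/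
noncomputable def SiegelSpace.imMatrix (τ₀ : SiegelSpace r) : Matrix (Fin r) (Fin r) ℂ :=
  (τ₀.1.map Complex.im).map Complex.ofReal

lemma SiegelSpace.posDef_imMatrix (τ₀ : SiegelSpace r) : τ₀.imMatrix.PosDef :=
  posDef_map_ofReal τ₀.2.2

/-- The special chart `c` computes the constant period matrix `τ₀` along `ι`, near the point with
coordinates `w` in the chart `d`. -/
structure IsFlatChartAt (K : SpecialKahlerStructure r X) (τ₀ : SiegelSpace r) (ι : S → X)
    (d : OpenPartialHomeomorph S (Cn s)) (w : Cn s) (c : SpecialChart r X) : Prop where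
  mem : c ∈ K.charts
  mem_source : ι (d.symm w) ∈ c.a.source
  eventually_eq : ∀ᶠ w' in 𝓝 w, hessian c.F (inCharts ι d c.a w') = τ₀.1

lemma exists_isFlatChartAt (hτ : IsPeriodMap K τ) (hι : Continuous ι) (hfib : ∀ x, τ (ι x) = τ₀)
    (hw : w ∈ d.target) : ∃ c, IsFlatChartAt K τ₀ ι d w c := by
  obtain ⟨c, hc, hwc, hev⟩ := hτ (ι (d.symm w))
  have hcont : ContinuousAt (fun w' => ι (d.symm w')) w :=
    hι.continuousAt.comp (d.continuousAt_symm hw)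
  refine ⟨c, hc, hwc, ?_⟩
  filter_upwards [hcont.eventually hev] with w' hw'
  rw [hfib] at hw'
  exact hw'.symm

/-- Being a flat chart is an open condition. -/
lemma IsFlatChartAt.eventually (h : IsFlatChartAt K τ₀ ι d w c) (hι : Continuous ι)
    (hw : w ∈ d.target) : ∀ᶠ w' in 𝓝 w, IsFlatChartAt K τ₀ ι d w' c := by
  filter_upwards [h.eventually_eq.eventually_nhds, eventually_mem_charts hι hw h.mem_source]
    with w' h1 h2 using ⟨h.mem, h2.2, h1⟩

variable [ChartedSpace (Cn s) S]

/-- Reduces the fiber to a submanifold of a flat Hermitian vector space. Equality on a neighborhood,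
not just at `w`, is what transfers the curvature. -/
lemma IsFlatChartAt.metricMatrix_eventuallyEq (h : IsFlatChartAt K τ₀ ι d w c)
    (hι : ContMDiff 𝓘(ℂ, Cn s) 𝓘(ℂ, Cn r) ω ι) (hd : d ∈ holCharts s S) (hw : w ∈ d.target) :
    metricMatrix (inducedMetric (s := s) K.metric ι) d
      =ᶠ[𝓝 w] pullbackMatrix (fun _ => τ₀.imMatrix) (inCharts ι d c.a) := by
  filter_upwards [metricMatrix_inducedMetric_eventuallyEq hι hd h.mem hw h.mem_source,
    h.eventually_eq] with w' h1 h2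
  rw [h1, pullbackMatrix, pullbackMatrix, SpecialChart.imHessian, h2, SiegelSpace.imMatrix]

lemma IsFlatChartAt.curvature_eq (h : IsFlatChartAt K τ₀ ι d w c)
    (hι : ContMDiff 𝓘(ℂ, Cn s) 𝓘(ℂ, Cn r) ω ι) (hd : d ∈ holCharts s S) (hw : w ∈ d.target)
    (u v : Cn s) :
    (chernConn (inducedMetric (s := s) K.metric ι) d).curvature w u v =
      (chernForm (pullbackMatrix (fun _ => τ₀.imMatrix) (inCharts ι d c.a))).curvature w u v := by
  refine curvature_congr ?_ u v
  filter_upwards [(h.metricMatrix_eventuallyEq hι hd hw).eventually_nhds] with w' hw' u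
  exact chernForm_congr hw' u

lemma IsFlatChartAt.curvatureMixed_eq (h : IsFlatChartAt K τ₀ ι d w c)
    (hι : ContMDiff 𝓘(ℂ, Cn s) 𝓘(ℂ, Cn r) ω ι) (hd : d ∈ holCharts s S) (hw : w ∈ d.target)
    (u v : Cn s) :
    (chernConn (inducedMetric (s := s) K.metric ι) d).curvatureMixed w u v =
      (chernForm (pullbackMatrix (fun _ => τ₀.imMatrix)
        (inCharts ι d c.a))).curvatureMixed w u v := by
  simp only [ConnForm.curvatureMixed, h.curvature_eq hι hd hw]

/-- In special coordinates, the ambient Chern connection vanishes along the fiber. -/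
lemma IsFlatChartAt.chernForm_imHessian_eq_zero (h : IsFlatChartAt K τ₀ ι d w c)
    (hι : ContMDiff 𝓘(ℂ, Cn s) 𝓘(ℂ, Cn r) ω ι) (hd : d ∈ holCharts s S) (hw : w ∈ d.target)
    (u : Cn s) :
    chernForm c.imHessian (inCharts ι d c.a w) (fderiv ℂ (inCharts ι d c.a) w u) = 0 := by
  have hz : inCharts ι d c.a w ∈ c.a.target := inCharts_mem_target h.mem_source
  have hf := (contMDiffAt_inCharts hι hd c.a_mem hw h.mem_source).differentiableAt (by simp)
  have h1 : (fun w' => hessian c.F (inCharts ι d c.a w')) =ᶠ[𝓝 w] fun _ => τ₀.1 :=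
    h.eventually_eq
  -- The derivative of `τ` in a direction tangent to the fiber is the derivative of a constant, and
  -- `∂(Im τ)` is a multiple of it.
  have h2 := matDeriv_congr h1 u
  rw [matDeriv_const, matDeriv_comp (c.differentiableAt_hessian hz).matDiffAt hf] at h2
  rw [chernForm_eq, c.matDel_imHessian hz, h2, smul_zero, Matrix.mul_zero]

end Fiber

/-! ### The restricted connection and the second fundamental form -/

section Restricted

/-- The Jacobian of the change from the chart `e` to the special coordinates `c`, along `ι`. -/
noncomputable def transitionAlong {r s : ℕ} {X S : Type*} [TopologicalSpace X]
    [ChartedSpace (Cn r) X] [TopologicalSpace S] (ι : S → X) (d : OpenPartialHomeomorph S (Cn s))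
    (e : OpenPartialHomeomorph X (Cn r)) (c : SpecialChart r X) (w : Cn s) :
    Matrix (Fin r) (Fin r) ℂ :=
  jac (inCharts id e c.a) (inCharts ι d e w)

variable {r s : ℕ} {X : Type*} [TopologicalSpace X] [ChartedSpace (Cn r) X]
  {S : Type*} [TopologicalSpace S] [ChartedSpace (Cn s) S]
  {K : SpecialKahlerStructure r X} {c : SpecialChart r X}
  {ι : S → X} {d : OpenPartialHomeomorph S (Cn s)} {e : OpenPartialHomeomorph X (Cn r)}
  {w : Cn s} {τ : X → SiegelSpace r} {τ₀ : SiegelSpace r}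

lemma contDiffAt_transition {z : Cn r} (he : e ∈ holCharts r X) (hz : z ∈ e.target)
    (hzc : e.symm z ∈ c.a.source) : ContDiffAt ℂ ω (inCharts id e c.a) z :=
  contMDiffAt_inCharts contMDiff_id he c.a_mem hz hzc

lemma contDiffAt_transitionAlong (hι : ContMDiff 𝓘(ℂ, Cn s) 𝓘(ℂ, Cn r) ω ι)
    (hd : d ∈ holCharts s S) (he : e ∈ holCharts r X) (hw : w ∈ d.target)
    (hwe : ι (d.symm w) ∈ e.source) (hwc : ι (d.symm w) ∈ c.a.source) (i j : Fin r) :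
    ContDiffAt ℂ ω (fun w' => transitionAlong ι d e c w' i j) w := by
  have hzc : e.symm (inCharts ι d e w) ∈ c.a.source := by
    rwa [inCharts, e.left_inv hwe]
  exact (contDiffAt_jac (contDiffAt_transition he (inCharts_mem_target hwe) hzc) i j).comp w
    (contMDiffAt_inCharts hι hd he hw hwe)

lemma jac_inCharts_eventuallyEq (hι : ContMDiff 𝓘(ℂ, Cn s) 𝓘(ℂ, Cn r) ω ι)
    (hd : d ∈ holCharts s S) (he : e ∈ holCharts r X) (hw : w ∈ d.target)
    (hwe : ι (d.symm w) ∈ e.source) (hwc : ι (d.symm w) ∈ c.a.source) :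
    jac (inCharts ι d c.a)
      =ᶠ[𝓝 w] fun w' => transitionAlong ι d e c w' * jac (inCharts ι d e) w' := by
  filter_upwards [eventually_mem_charts hι.continuous hw hwe,
    eventually_mem_charts hι.continuous hw hwc] with w' h1 h2
  have hzc : e.symm (inCharts ι d e w') ∈ c.a.source := by
    rw [inCharts, e.left_inv h1.2]
    exact h2.2
  have hφ := (contDiffAt_transition he (inCharts_mem_target h1.2) hzc).differentiableAt
    (by simp)
  have hf := (contMDiffAt_inCharts hι hd he h1.1 h1.2).differentiableAt (by simp)
  have hev := inCharts_eventuallyEq_comp (e' := c.a) hι.continuous h1.1 h1.2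
  have hder : fderiv ℂ (inCharts ι d c.a) w' = _ :=
    hev.fderiv_eq.trans (hφ.hasFDerivAt.comp w' hf.hasFDerivAt).fderiv
  ext i j
  have h3 := congrFun (jac_mulVec (inCharts id e c.a) (inCharts ι d e w')
    (fderiv ℂ (inCharts ι d e) w' (basisVec j))) i
  simp only [jac, Matrix.of_apply, hder]
  exact h3.symm

variable [IsManifold 𝓘(ℂ, Cn r) ω X]

lemma isUnit_det_transitionAlong {S : Type*} [TopologicalSpace S] {ι : S → X}
    {d : OpenPartialHomeomorph S (Cn s)} (he : e ∈ holCharts r X) (hwe : ι (d.symm w) ∈ e.source)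
    (hwc : ι (d.symm w) ∈ c.a.source) : IsUnit (transitionAlong ι d e c w).det := by
  refine isUnit_det_jac_transition he (inCharts_mem_target hwe) ?_
  rwa [inCharts, e.left_inv hwe]

/-- The restricted connection is pure gauge. -/
lemma IsFlatChartAt.restrictedConn_eq (h : IsFlatChartAt K τ₀ ι d w c)
    (hι : ContMDiff 𝓘(ℂ, Cn s) 𝓘(ℂ, Cn r) ω ι) (hd : d ∈ holCharts s S) (he : e ∈ holCharts r X)
    (hw : w ∈ d.target) (hwe : ι (d.symm w) ∈ e.source) (u : Cn s) :
    restrictedConn K.metric ι d e w u =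
      (transitionAlong ι d e c w)⁻¹ * matDeriv (transitionAlong ι d e c) w u := by
  have hzc : e.symm (inCharts ι d e w) ∈ c.a.source := by
    rw [inCharts, e.left_inv hwe]
    exact h.mem_source
  have hz : inCharts ι d e w ∈ e.target := inCharts_mem_target hwe
  have hφ := contDiffAt_transition he hz hzc
  have hf := (contMDiffAt_inCharts hι hd he hw hwe).differentiableAt (by simp)
  have hev := inCharts_eventuallyEq_comp (e' := c.a) hι.continuous hw hwe
  have hder : fderiv ℂ (inCharts ι d c.a) w = _ :=
    hev.fderiv_eq.trans
      ((hφ.differentiableAt (by simp)).hasFDerivAt.comp w hf.hasFDerivAt).fderiv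
  have hzero : chernForm c.imHessian (inCharts id e c.a (inCharts ι d e w))
      (fderiv ℂ (inCharts id e c.a) (inCharts ι d e w) (fderiv ℂ (inCharts ι d e) w u)) = 0 := by
    have h0 := h.chernForm_imHessian_eq_zero hι hd hw u
    rw [hder, hev.eq_of_nhds] at h0
    exact h0
  have hG : matDeriv (transitionAlong ι d e c) w u = _ :=
    matDeriv_comp (matHolAt_jac hφ).matDiffAt hf u
  -- Only the inhomogeneous term of the change-of-frame law remains.
  rw [restrictedConn, ConnForm.pullback, chernConn_eq h.mem he hz hzc, hzero, Matrix.zero_mul,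
    zero_add, hG, transitionAlong]

/-- For `A = G⁻¹ dG`, the term `d(G⁻¹) ∧ dG` equals `-A ∧ A`. -/
lemma IsFlatChartAt.restrictedConn_curvature (h : IsFlatChartAt K τ₀ ι d w c)
    (hι : ContMDiff 𝓘(ℂ, Cn s) 𝓘(ℂ, Cn r) ω ι) (hd : d ∈ holCharts s S) (he : e ∈ holCharts r X)
    (hw : w ∈ d.target) (hwe : ι (d.symm w) ∈ e.source) (u v : Cn s) :
    (restrictedConn K.metric ι d e).curvature w u v = 0 := by
  have hG := contDiffAt_transitionAlong hι hd he hw hwe h.mem_source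
  have hGd : MatDiffAt (transitionAlong ι d e c) w := fun i j =>
    ((hG i j).differentiableAt (by simp)).restrictScalars ℝ
  have hdet := isUnit_det_transitionAlong he hwe h.mem_source
  have hev : ∀ᶠ w' in 𝓝 w, ∀ u, restrictedConn K.metric ι d e w' u =
      (transitionAlong ι d e c w')⁻¹ * matDeriv (transitionAlong ι d e c) w' u := by
    filter_upwards [h.eventually hι.continuous hw, eventually_mem_charts hι.continuous hw hwe]
      with w' h1 h2 u using h1.restrictedConn_eq hι hd he h2.1 h2.2 u
  rw [curvature_congr hev, curvature_mul_matDeriv (hGd.inv hdet)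
    fun i j => ((hG i j).restrict_scalars ℝ).of_le le_top]
  simp only [matDeriv_inv hGd hdet, Matrix.neg_mul, Matrix.mul_assoc]
  abel

/-- The second fundamental form in an arbitrary chart, in terms of special coordinates. -/
lemma IsFlatChartAt.transitionAlong_mulVec (h : IsFlatChartAt K τ₀ ι d w c)
    (hι : ContMDiff 𝓘(ℂ, Cn s) 𝓘(ℂ, Cn r) ω ι) (hd : d ∈ holCharts s S) (he : e ∈ holCharts r X)
    (hw : w ∈ d.target) (hwe : ι (d.symm w) ∈ e.source) (u v : Cn s) :
    transitionAlong ι d e c w *ᵥ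
      (fderiv ℝ (fun w' => fderiv ℂ (inCharts ι d e) w' v) w u
        + act (restrictedConn K.metric ι d e w u) (fderiv ℂ (inCharts ι d e) w v)).ofLp
      = matDeriv (jac (inCharts ι d c.a)) w u *ᵥ v.ofLp := by
  have hG := contDiffAt_transitionAlong hι hd he hw hwe h.mem_source
  have hGd : MatDiffAt (transitionAlong ι d e c) w := fun i j =>
    ((hG i j).differentiableAt (by simp)).restrictScalars ℝ
  have hdet := isUnit_det_transitionAlong he hwe h.mem_source
  have hf := contMDiffAt_inCharts hι hd he hw hwe
  -- With `J = G J_e`, the product rule gives `dJ = G (dJ_e + G⁻¹ dG J_e)`, and `G⁻¹ dG` is the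
  -- restricted connection.
  rw [matDeriv_congr (jac_inCharts_eventuallyEq hι hd he hw hwe h.mem_source),
    matDeriv_mul hGd (matHolAt_jac hf).matDiffAt, fderiv_fderiv_apply hf,
    h.restrictedConn_eq hι hd he hw hwe, act, WithLp.ofLp_add, Matrix.mulVec_add,
    Matrix.mulVec_mulVec, Matrix.mul_nonsing_inv_cancel_left _ _ hdet, Matrix.add_mulVec,
    ← matDeriv_jac_mulVec hf, ← jac_mulVec, Matrix.mulVec_mulVec, Matrix.mulVec_mulVec, add_comm]

/-- The invertible matrix `G` carries the tangent space of the fiber in the chart `e` to the one in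
special coordinates, so tangency can be tested where the connection term is absent. -/
lemma IsFlatChartAt.exists_tangent_iff (h : IsFlatChartAt K τ₀ ι d w c)
    (hι : ContMDiff 𝓘(ℂ, Cn s) 𝓘(ℂ, Cn r) ω ι) (hd : d ∈ holCharts s S) (he : e ∈ holCharts r X)
    (hw : w ∈ d.target) (hwe : ι (d.symm w) ∈ e.source) (u v : Cn s) :
    (∃ t : Cn s, fderiv ℝ (fun w' => fderiv ℂ (inCharts ι d e) w' v) w u
        + act (restrictedConn K.metric ι d e w u) (fderiv ℂ (inCharts ι d e) w v)
      = fderiv ℂ (inCharts ι d e) w t) ↔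
    ∃ t : Fin s → ℂ, matDeriv (jac (inCharts ι d c.a)) w u *ᵥ v.ofLp
      = jac (inCharts ι d c.a) w *ᵥ t := by
  have hdet := isUnit_det_transitionAlong he hwe h.mem_source
  have hinj : Function.Injective (transitionAlong ι d e c w).mulVec :=
    Matrix.mulVec_injective_iff_isUnit.2 ((Matrix.isUnit_iff_isUnit_det _).2 hdet)
  have hjac := (jac_inCharts_eventuallyEq hι hd he hw hwe h.mem_source).eq_of_nhds
  have key := h.transitionAlong_mulVec hι hd he hw hwe u v
  constructor
  · rintro ⟨t, ht⟩
    refine ⟨t.ofLp, ?_⟩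
    rw [← key, ht, hjac, ← jac_mulVec, Matrix.mulVec_mulVec]
  · rintro ⟨t, ht⟩
    refine ⟨WithLp.toLp 2 t, WithLp.ofLp_injective 2 (hinj ?_)⟩
    simp only
    rw [key, ht, hjac, ← jac_mulVec, Matrix.mulVec_mulVec]

end Restricted

/-! ### Curvature of the fibers -/

section FiberCurvature

variable {r s : ℕ} {X : Type*} [TopologicalSpace X] [ChartedSpace (Cn r) X]
  [IsManifold 𝓘(ℂ, Cn r) ω X]
  {S : Type*} [TopologicalSpace S] [ChartedSpace (Cn s) S]
  {K : SpecialKahlerStructure r X} {ι : S → X} {τ : X → SiegelSpace r} {τ₀ : SiegelSpace r}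

theorem restrictedTangentFlat_of_fiber (hτ : IsPeriodMap K τ)
    (hι : ContMDiff 𝓘(ℂ, Cn s) 𝓘(ℂ, Cn r) ω ι) (hfib : ∀ x, τ (ι x) = τ₀) :
    RestrictedTangentFlat (s := s) K.metric ι := by
  intro d hd e he w hw hwe u v
  obtain ⟨c, h⟩ := exists_isFlatChartAt hτ hι.continuous hfib hw
  exact h.restrictedConn_curvature hι hd he hw hwe u v

variable [IsManifold 𝓘(ℂ, Cn s) ω S]

theorem nakanoNonpos_of_fiber (hτ : IsPeriodMap K τ)
    (hι : Manifold.IsImmersion 𝓘(ℂ, Cn s) 𝓘(ℂ, Cn r) ω ι) (hfib : ∀ x, τ (ι x) = τ₀) :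
    NakanoNonpos (inducedMetric (s := s) K.metric ι) := by
  intro d hd w hw u
  obtain ⟨c, h⟩ := exists_isFlatChartAt hτ hι.contMDiff.continuous hfib hw
  have hf := contMDiffAt_inCharts hι.contMDiff hd c.a_mem hw h.mem_source
  have hinj := fderiv_inCharts_injective hι.contMDiff (mfderiv_injective_of_isImmersion hι) hd
    c.a_mem hw h.mem_source
  have hpos := τ₀.posDef_imMatrix
  have hdet := isUnit_det_of_posDef
    (posDef_pullbackMatrix (H := fun _ => τ₀.imMatrix) hpos hinj)
  have hnn := sum_nakano_nonneg (posSemidef_normalForm hpos hinj)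
    (fun i => matDeriv (jac (inCharts ι d c.a)) w (basisVec i)) u
  -- Lowering the index with `h` cancels the `h⁻¹` of the Gauss equation.
  simp only [riemann, h.curvatureMixed_eq hι.contMDiff hd hw,
    (h.metricMatrix_eventuallyEq hι.contMDiff hd hw).eq_of_nhds,
    curvatureMixed_pullback_const hf hpos hinj, Matrix.mul_neg,
    Matrix.mul_nonsing_inv_cancel_left _ _ hdet, Matrix.neg_apply, neg_mul,
    Finset.sum_neg_distrib]
  exact neg_nonpos.2 hnn

theorem ricciNonpos_of_fiber (hτ : IsPeriodMap K τ)
    (hι : Manifold.IsImmersion 𝓘(ℂ, Cn s) 𝓘(ℂ, Cn r) ω ι) (hfib : ∀ x, τ (ι x) = τ₀) :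
    RicciNonpos (inducedMetric (s := s) K.metric ι) := by
  intro d hd w hw u
  obtain ⟨c, h⟩ := exists_isFlatChartAt hτ hι.contMDiff.continuous hfib hw
  have hf := contMDiffAt_inCharts hι.contMDiff hd c.a_mem hw h.mem_source
  have hinj := fderiv_inCharts_injective hι.contMDiff (mfderiv_injective_of_isImmersion hι) hd
    c.a_mem hw h.mem_source
  have hpos := τ₀.posDef_imMatrix
  -- Here `h⁻¹` is not cancelled: it is the positive factor inside the trace.
  have hnn := sum_trace_nonneg (posSemidef_normalForm hpos hinj)
    (posDef_pullbackMatrix (H := fun _ => τ₀.imMatrix) hpos hinj).inv.posSemidef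
    (fun i => matDeriv (jac (inCharts ι d c.a)) w (basisVec i)) u
  simp only [ricci, h.curvatureMixed_eq hι.contMDiff hd hw,
    curvatureMixed_pullback_const hf hpos hinj, Matrix.trace_neg, neg_mul,
    Finset.sum_neg_distrib]
  exact neg_nonpos.2 hnn

theorem isFlat_iff_isTotallyGeodesic_of_fiber (hτ : IsPeriodMap K τ)
    (hι : Manifold.IsImmersion 𝓘(ℂ, Cn s) 𝓘(ℂ, Cn r) ω ι) (hfib : ∀ x, τ (ι x) = τ₀) :
    IsFlat (inducedMetric (s := s) K.metric ι) ↔ IsTotallyGeodesic (s := s) K.metric ι := by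
  have hpos := τ₀.posDef_imMatrix
  constructor
  · intro hflat d hd e he w hw hwe u v
    obtain ⟨c, h⟩ := exists_isFlatChartAt hτ hι.contMDiff.continuous hfib hw
    have hf := contMDiffAt_inCharts hι.contMDiff hd c.a_mem hw h.mem_source
    have hinj := fderiv_inCharts_injective hι.contMDiff (mfderiv_injective_of_isImmersion hι) hd
      c.a_mem hw h.mem_source
    have hdet := isUnit_det_of_posDef
      (posDef_pullbackMatrix (H := fun _ => τ₀.imMatrix) hpos hinj)
    rw [h.exists_tangent_iff hι.contMDiff hd he hw hwe]
    -- The diagonal value `R(u, ū)` suffices: its vanishing says `β_uᴴ N β_u = 0`, so every `β_u v`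
    -- has `N`-norm zero.
    have hmixed : (chernConn (inducedMetric (s := s) K.metric ι) d).curvatureMixed w u u = 0 := by
      simp [ConnForm.curvatureMixed, hflat d hd w hw]
    rw [h.curvatureMixed_eq hι.contMDiff hd hw, curvatureMixed_pullback_const hf hpos hinj,
      neg_eq_zero] at hmixed
    have hzero := congrArg (pullbackMatrix (fun _ => τ₀.imMatrix) (inCharts ι d c.a) w * ·) hmixed
    simp only [Matrix.mul_nonsing_inv_cancel_left _ _ hdet, Matrix.mul_zero] at hzero
    refine ⟨_, eq_jac_mulVec_of_normalForm hpos hinj ?_⟩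
    rw [← sum_conjTranspose_mul_mul, hzero]
    simp
  · intro hgeo d hd w hw u v
    obtain ⟨c, h⟩ := exists_isFlatChartAt hτ hι.contMDiff.continuous hfib hw
    have hf := contMDiffAt_inCharts hι.contMDiff hd c.a_mem hw h.mem_source
    have hinj := fderiv_inCharts_injective hι.contMDiff (mfderiv_injective_of_isImmersion hι) hd
      c.a_mem hw h.mem_source
    have hnormal : ∀ u, normalForm τ₀.imMatrix (inCharts ι d c.a) w
        * matDeriv (jac (inCharts ι d c.a)) w u = 0 := by
      intro u
      refine Matrix.ext_of_mulVec_single fun j => ?_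
      -- Total geodesy is used in the special chart itself, one column of `β_u` at a time; `N`
      -- annihilates tangent vectors.
      obtain ⟨t, ht⟩ := (h.exists_tangent_iff hι.contMDiff hd c.a_mem hw h.mem_source u
        (WithLp.toLp 2 (Pi.single j 1))).1 (hgeo d hd c.a c.a_mem w hw h.mem_source u _)
      have ht' : matDeriv (jac (inCharts ι d c.a)) w u *ᵥ Pi.single j 1
          = jac (inCharts ι d c.a) w *ᵥ t := ht
      rw [← Matrix.mulVec_mulVec, ht', Matrix.mulVec_mulVec, normalForm_mul_jac hpos hinj,
        Matrix.zero_mulVec, Matrix.zero_mulVec]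
    rw [h.curvature_eq hι.contMDiff hd hw, curvature_pullback_const hf hpos hinj]
    simp only [Matrix.mul_assoc, hnormal, Matrix.mul_zero, sub_self]

end FiberCurvature

end SpecialGeometry

theorem mainTheorem7 {r s : ℕ}
    {X : Type*} [TopologicalSpace X] [ChartedSpace (Cn r) X] [IsManifold 𝓘(ℂ, Cn r) ω X]
    (K : SpecialKahlerStructure r X) (τ : X → SiegelSpace r) (hτ : IsPeriodMap K τ)
    (τ₀ : SiegelSpace r)
    {S : Type*} [TopologicalSpace S] [ChartedSpace (Cn s) S] [IsManifold 𝓘(ℂ, Cn s) ω S]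
    (ι : S → X) (hι : Manifold.IsSmoothEmbedding 𝓘(ℂ, Cn s) 𝓘(ℂ, Cn r) ω ι)
    (hfiber : Set.range ι = τ ⁻¹' {τ₀}) :
    (ChernIsLeviCivita K.metric ∧ RestrictedTangentFlat (s := s) K.metric ι) ∧
    (ChernIsLeviCivita (inducedMetric (s := s) K.metric ι) ∧
      NakanoNonpos (inducedMetric (s := s) K.metric ι) ∧
      RicciNonpos (inducedMetric (s := s) K.metric ι) ∧
      BisectionalNonpos (inducedMetric (s := s) K.metric ι)) ∧
    (IsFlat (inducedMetric (s := s) K.metric ι) ↔ IsTotallyGeodesic (s := s) K.metric ι) ∧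
    (IsTotallyGeodesic (s := s) K.metric ι → IsHolomorphicFlat (s := s) K.metric ι) := by
  have hfib : ∀ x, τ (ι x) = τ₀ := fun x => by
    have h : ι x ∈ τ ⁻¹' {τ₀} := hfiber ▸ Set.mem_range_self x
    exact h
  have himm := hι.isImmersion
  have hnak := nakanoNonpos_of_fiber hτ himm hfib
  have hiff := isFlat_iff_isTotallyGeodesic_of_fiber hτ himm hfib
  exact ⟨⟨chernIsLeviCivita_metric K, restrictedTangentFlat_of_fiber hτ himm.contMDiff hfib⟩,
    ⟨chernIsLeviCivita_inducedMetric K himm, hnak, ricciNonpos_of_fiber hτ himm hfib,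
      hnak.bisectionalNonpos⟩, hiff, fun h => ⟨hι, h, hiff.2 h⟩⟩
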